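/- **Theorem 1.2 (Maximizers of the quantum entropy).** Let $\mathbb T^d=\mathbb R^d/(2\pi\mathbb Z)^d$ with Lebesgue measure $dp$ of total mass $(2\pi)^d$, and let $\omega:\mathbb T^d\to[0,1]$ be continuous with $\min\omega=a\ge 0$ and $\max\omega=1$, both attained only on sets of measure zero. For a nonnegative Borel measure $\lambda=f\,dp+\lambda_{\rm sing}$ on $\mathbb T^d$ (Lebesgue decomposition) put $$\mathcal M(\lambda)=\int d\lambda,\qquad \mathcal E(\lambda)=\int\omega\,d\lambda,\qquad \mathcal H_{qu}(\lambda)=\int_{\mathbb T^d}\big[(1+f)\ln(1+f)-f\ln f\big]\,dp .$$ For $\mu,\nu\in\mathbb R$ with $\mu\omega+\nu\ge0$ on $\mathbb T^d$ let $B_{\mu,\nu}=\dfrac{1}{e^{\mu\omega+\nu}-1}$ (Bose–Einstein equilibrium), identified with the measure $B_{\mu,\nu}\,dp$. Let $$\alpha=a+(2\pi)^d\Big(\int\frac{dp}{\omega-a}\Big)^{-1},\qquad \beta=1-(2\pi)^d\Big(\int\frac{dp}{1-\omega}\Big)^{-1},\qquad \infty^{-1}=0 .$$ There are functions $f_\pm:[0,\infty)\to\mathbb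 R$ with $f_\pm(0)=0$ such that: * if $\int\frac{dp}{1-\omega}<\infty$, the curve $\mathcal C_+=\{(\mathcal M(B_{-t,t}),\mathcal E(B_{-t,t})):t>0\}$ is the graph of $f_+$ over $(0,\infty)$; if $\int\frac{dp}{1-\omega}=\infty$, then $f_+(\mathcal M)=\mathcal M$; * if $\int\frac{dp}{\omega-a}<\infty$, the curve $\mathcal C_-=\{(\mathcal M(B_{t,-at}),\mathcal E(B_{t,-at})):t>0\}$ is the graph of $f_-$ over $(0,\infty)$; if $\int\frac{dp}{\omega-a}=\infty$, then $f_-(\mathcal M)=a\mathcal M$; * $f_\pm$ are differentiable (one-sidedly at $0$); $f_+$ is strictly increasing, and $f_-$ is nondecreasing, and strictly increasing unless $a=0$ and $\int\frac{dp}{\omega}=\infty$ (in which case $f_-\equiv0$); $f_+(\mathcal M)/\mathcal M\to\beta$ and $f_-(\mathcal M)/\mathcal M\to\alpha$ as $\mathcal M\to\infty$; and $f_-(\mathcal M)<f_+(\mathcal M)$ for $\mathcal M>0$. For all $\mathcal M_0,\mathcal E_0\in(0,\infty)$, the maximizers of $\mathcal H_{qu}$ among the nonnegative measures $\lambda$ with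 $\mathcal M(\lambda)=\mathcal M_0$ and $\mathcal E(\lambda)=\mathcal E_0$ are as follows. 1. If $f_-(\mathcal M_0)<\mathcal E_0<f_+(\mathcal M_0)$, there is exactly one pair $(\mu,\nu)$ with $\mu\omega+\nu\ge0$, $\mathcal M(B_{\mu,\nu})=\mathcal M_0$ and $\mathcal E(B_{\mu,\nu})=\mathcal E_0$, and $B_{\mu,\nu}$ is the unique maximizer. 2. If $f_+(\mathcal M_0)\le\mathcal E_0<\mathcal M_0$, there are $t>0$ and $m\ge0$ with $\mathcal M(B_{-t,t})+m=\mathcal M_0$ and $\mathcal E(B_{-t,t})+m=\mathcal E_0$, such that the maximizers are exactly the measures $B_{-t,t}+\lambda_{\rm sing}$ with $\lambda_{\rm sing}$ a nonnegative singular measure of mass $m$ concentrated on $\{\omega=1\}$. 3. If $a\mathcal M_0<\mathcal E_0\le f_-(\mathcal M_0)$, there are $t>0$ and $m\ge0$ with $\mathcal M(B_{t,-at})+m=\mathcal M_0$ and $\mathcal E(B_{t,-at})+am=\mathcal E_0$, such that the maximizers are exactly the measures $B_{t,-at}+\lambda_{\rm sing}$ with $\lambda_{\rm sing}$ a nonnegative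 singular measure of mass $m$ concentrated on $\{\omega=a\}$. -/

import Mathlib

open MeasureTheory Set Filter Topology
open scoped ENNReal

noncomputable section

namespace EntropyMax

/-- The torus `ℝ^d / (2πℤ)^d`. Its `volume` is Lebesgue measure `dp`, of total mass `(2π)^d`. -/
abbrev Torus (d : ℕ) : Type := Fin d → AddCircle (2 * Real.pi)

instance fact_two_pi_pos : Fact (0 < 2 * Real.pi) := ⟨Real.two_pi_pos⟩

variable {d : ℕ}

/-- The mass `∫ dρ` of a nonnegative measure. -/
def mass (ρ : Measure (Torus d)) : ℝ≥0∞ := ρ univ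

/-- The energy `∫ ω dρ` of a nonnegative measure (with `ω ≥ 0`). -/
def energy (ω : Torus d → ℝ) (ρ : Measure (Torus d)) : ℝ≥0∞ :=
  ∫⁻ p, ENNReal.ofReal (ω p) ∂ρ

/-- The quantum entropy density `(1 + x) ln (1 + x) - x ln x` (with `0 ln 0 = 0`). -/
def entropyDensity (x : ℝ) : ℝ := (1 + x) * Real.log (1 + x) - x * Real.log x

/-- The quantum entropy of a measure, computed from the density `f` of its absolutely
continuous part in the Lebesgue decomposition `ρ = f dp + ρ_sing`.
For a finite measure the integrand is nonnegative, bounded by `1 + f`, hence integrable. -/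
def entropy (ρ : Measure (Torus d)) : ℝ :=
  ∫ p, entropyDensity (ρ.rnDeriv volume p).toReal

/-- The nonnegative measures with mass `M₀` and energy `E₀`. -/
def constraintSet (ω : Torus d → ℝ) (M₀ E₀ : ℝ) : Set (Measure (Torus d)) :=
  {ρ | mass ρ = ENNReal.ofReal M₀ ∧ energy ω ρ = ENNReal.ofReal E₀}

/-- `ρ` maximizes the quantum entropy among nonnegative measures of mass `M₀`, energy `E₀`. -/
def IsMaximizer (ω : Torus d → ℝ) (M₀ E₀ : ℝ) (ρ : Measure (Torus d)) : Prop :=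
  ρ ∈ constraintSet ω M₀ E₀ ∧ IsMaxOn entropy (constraintSet ω M₀ E₀) ρ

/-- The parameters for which the Bose-Einstein density is nonnegative. -/
def IsBoseParam (ω : Torus d → ℝ) (μ ν : ℝ) : Prop := ∀ p, 0 ≤ μ * ω p + ν

/-- The Bose-Einstein equilibrium `B_{μ,ν}(p) dp`, where
`B_{μ,ν}(p) = 1 / (e^{μ ω(p) + ν} - 1)`, which is `+∞` where the denominator vanishes. -/
def bose (ω : Torus d → ℝ) (μ ν : ℝ) : Measure (Torus d) :=
  volume.withDensity fun p => (ENNReal.ofReal (Real.exp (μ * ω p + ν) - 1))⁻¹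

/-- `∫ dp / (ω - a) ∈ [0, ∞]`. -/
def lowerIntegral (ω : Torus d → ℝ) (a : ℝ) : ℝ≥0∞ :=
  ∫⁻ p, (ENNReal.ofReal (ω p - a))⁻¹

/-- `∫ dp / (1 - ω) ∈ [0, ∞]`. -/
def upperIntegral (ω : Torus d → ℝ) : ℝ≥0∞ :=
  ∫⁻ p, (ENNReal.ofReal (1 - ω p))⁻¹

/-- `α = a + (2π)^d (∫ dp / (ω - a))⁻¹`, equal to `a` if the integral is infinite. -/
def alpha (ω : Torus d → ℝ) (a : ℝ) : ℝ :=
  a + (2 * Real.pi) ^ d * ((lowerIntegral ω a)⁻¹).toReal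

/-- `β = 1 - (2π)^d (∫ dp / (1 - ω))⁻¹`, equal to `1` if the integral is infinite. -/
def beta (ω : Torus d → ℝ) : ℝ :=
  1 - (2 * Real.pi) ^ d * ((upperIntegral ω)⁻¹).toReal

/-- The curve `C₊` of pairs (mass, energy) of `B_{-t,t}`, `t > 0`.
It is used only when `upperIntegral ω` is finite, in which case these are finite. -/
def curvePlus (ω : Torus d → ℝ) : Set (ℝ × ℝ) :=
  (fun t : ℝ => ((mass (bose ω (-t) t)).toReal, (energy ω (bose ω (-t) t)).toReal)) '' Ioi 0

/-- The curve `C₋` of pairs (mass, energy) of `B_{t,-at}`, `t > 0`.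
It is used only when `lowerIntegral ω a` is finite, in which case these are finite. -/
def curveMinus (ω : Torus d → ℝ) (a : ℝ) : Set (ℝ × ℝ) :=
  (fun t : ℝ => ((mass (bose ω t (-a * t))).toReal,
    (energy ω (bose ω t (-a * t))).toReal)) '' Ioi 0

/-- `f₊` is the function on `[0, ∞)` vanishing at `0` whose graph over `(0, ∞)` is `C₊`;
when `∫ dp / (1 - ω) = ∞` it is the upper boundary `E = M` of the admissible cone. -/
def IsUpperCurve (ω : Torus d → ℝ) (f : ℝ → ℝ) : Prop :=
  f 0 = 0 ∧
  (upperIntegral ω < ∞ → curvePlus ω = {x | 0 < x.1 ∧ x.2 = f x.1}) ∧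
  (upperIntegral ω = ∞ → ∀ M, 0 < M → f M = M)

/-- `f₋` is the function on `[0, ∞)` vanishing at `0` whose graph over `(0, ∞)` is `C₋`;
when `∫ dp / (ω - a) = ∞` it is the lower boundary `E = a M` of the admissible cone. -/
def IsLowerCurve (ω : Torus d → ℝ) (a : ℝ) (f : ℝ → ℝ) : Prop :=
  f 0 = 0 ∧
  (lowerIntegral ω a < ∞ → curveMinus ω a = {x | 0 < x.1 ∧ x.2 = f x.1}) ∧
  (lowerIntegral ω a = ∞ → ∀ M, 0 < M → f M = a * M)

end EntropyMax

end

open EntropyMax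

/-! The tangent to the concave entropy density at `planck s` has slope `s`. Let `s = μω + ν ≥ 0` and
`B = planck s`. For a competitor with density `f` and singular part `σ`, the constraints fix `∫ s f
+ ∫ s dσ`, and `∫ s dσ ≥ 0`. If `B` together with a condensate on `{s = 0}` meets the constraints,
then `∫ s f ≤ ∫ s B`. Integrating the tangent inequality gives `H(f) ≤ H(B)`, with equality only for
`f = B` a.e. (`integral_entropyDensity_le`); in that case `∫ s dσ = 0`, so `σ` lives on `{s = 0}`.
Thus `isMaximizer_iff_exists_condensate` reduces the theorem to solving the constraints for the
parameters and the condensate.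

Write `s = x(1 - ω) + y(ω - a)`; then `s ≥ 0` means `x, y ≥ 0`, and the two edges of this quadrant
carry the critical equilibria. Both edges are treated alike, with `g = 1 - ω` or `g = ω - a`. If `∫
1/g < ∞`, the mass `∫ planck (t g)` decreases strictly from `∞` to `0`, so the excess energy `∫ g
planck (t g)` is a function `F` of the mass (`IsBoundaryFunction`). The two curves are `M - F₁ M`
and `a M + F₂ M`. They are kept apart by Chebyshev's inequality (`integral_mul_planck_lt_average`).
On or beyond a curve, the intermediate value theorem picks the mass of the equilibrium that carries
all of the excess energy, and the remaining mass condenses on `{g = 0}`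
(`IsBoundaryFunction.exists_condensate`).

Between the curves, the convex dual functional `∫ -ln(1 - e^{-s}) + x(M₀ - E₀) + y(E₀ - a M₀)` has a
minimizer on the closed quadrant (`exists_dual_minimizer`). At an interior minimizer, stationarity
is exactly the pair of constraints. A minimizer on an edge would satisfy one constraint with
equality and the other as an inequality, which would place `(M₀, E₀)` on or beyond a curve
(`IsBoundaryFunction.le_of_lintegral_boseDensity`). -/

namespace EntropyMax

/-! ### The Planck function -/

/-- The Planck function `1 / (e^s - 1)`, with value `0` at `s = 0`. -/
noncomputable def planck (s : ℝ) : ℝ := (Real.exp s - 1)⁻¹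

theorem exp_sub_one_pos {s : ℝ} (hs : 0 < s) : 0 < Real.exp s - 1 := by
  linarith [Real.add_one_lt_exp hs.ne']

theorem planck_pos {s : ℝ} (hs : 0 < s) : 0 < planck s := inv_pos.2 (exp_sub_one_pos hs)

theorem planck_nonneg {s : ℝ} (hs : 0 ≤ s) : 0 ≤ planck s :=
  inv_nonneg.2 (by linarith [Real.add_one_le_exp s])

theorem planck_le_inv {s : ℝ} (hs : 0 < s) : planck s ≤ s⁻¹ :=
  inv_anti₀ hs (by linarith [Real.add_one_le_exp s])

theorem planck_lt_planck {s r : ℝ} (hs : 0 < s) (hsr : s < r) : planck r < planck s :=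
  inv_strictAnti₀ (exp_sub_one_pos hs) (by linarith [Real.exp_lt_exp.2 hsr])

theorem planck_le_planck {s r : ℝ} (hs : 0 < s) (hsr : s ≤ r) : planck r ≤ planck s :=
  inv_anti₀ (exp_sub_one_pos hs) (by linarith [Real.exp_le_exp.2 hsr])

theorem measurable_planck : Measurable planck := by unfold planck; fun_prop

theorem hasDerivAt_planck {s : ℝ} (hs : 0 < s) :
    HasDerivAt planck (-(planck s + planck s ^ 2)) s := by
  have h := ((Real.hasDerivAt_exp s).sub_const 1).fun_inv (exp_sub_one_pos hs).ne'
  refine h.congr_deriv ?_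
  have := (exp_sub_one_pos hs).ne'
  unfold planck
  field_simp
  ring

/-- The reciprocal of `t * planck (t * x)` is the difference quotient of `exp (t * x)` at `t = 0`.
-/
theorem tendsto_mul_planck {x : ℝ} (hx : 0 < x) :
    Tendsto (fun t => t * planck (t * x)) (𝓝[>] 0) (𝓝 x⁻¹) := by
  have h : HasDerivAt (fun t : ℝ => Real.exp (t * x)) x 0 := by
    have := ((hasDerivAt_id (0 : ℝ)).mul_const x).exp
    simpa using this
  have h2 := (hasDerivAt_iff_tendsto_slope.1 h).mono_left
    (nhdsWithin_mono 0 fun t (ht : 0 < t) => ht.ne')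
  refine (h2.inv₀ hx.ne').congr' ?_
  filter_upwards [self_mem_nhdsWithin] with t (ht : 0 < t)
  simp [slope, planck, mul_comm]

/-! ### Integrals of critical densities as functions of `t` -/

section Weighted

variable {X : Type*} [MeasurableSpace X] {P : Measure X} {g w : X → ℝ}

theorem integrable_inv_of_lintegral (hg : Measurable g) (h0 : ∀ᵐ p ∂P, 0 < g p)
    (h : ∫⁻ p, (ENNReal.ofReal (g p))⁻¹ ∂P < ∞) : Integrable (fun p => (g p)⁻¹) P := by
  have h1 := integrable_toReal_of_lintegral_ne_top (by fun_prop) h.ne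
  refine h1.congr ?_
  filter_upwards [h0] with p hp
  rw [ENNReal.toReal_inv, ENNReal.toReal_ofReal hp.le]

theorem integral_inv_eq_toReal (hg : Measurable g) (h0 : ∀ᵐ p ∂P, 0 < g p) :
    ∫ p, (g p)⁻¹ ∂P = (∫⁻ p, (ENNReal.ofReal (g p))⁻¹ ∂P).toReal := by
  rw [← integral_toReal (by fun_prop)]
  · refine integral_congr_ae ?_
    filter_upwards [h0] with p hp
    rw [ENNReal.toReal_inv, ENNReal.toReal_ofReal hp.le]
  · filter_upwards [h0] with p hp
    simpa using hp

theorem integral_pos_of_ae_pos (hP : P ≠ 0) {f : X → ℝ} (hf : ∀ᵐ p ∂P, 0 < f p)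
    (hi : Integrable f P) : 0 < ∫ p, f p ∂P := by
  rw [integral_pos_iff_support_of_nonneg_ae (hf.mono fun p hp => hp.le) hi]
  have : Function.support f =ᵐ[P] univ := by
    filter_upwards [hf] with p hp
    exact eq_true hp.ne'
  rw [measure_congr this]
  exact (Measure.measure_univ_ne_zero.2 hP).bot_lt

theorem integrable_mul_planck (hg : Measurable g) (h0 : ∀ᵐ p ∂P, 0 < g p)
    (hI : Integrable (fun p => (g p)⁻¹) P) (hw : Measurable w) (hw1 : ∀ p, |w p| ≤ 1)
    {t : ℝ} (ht : 0 < t) : Integrable (fun p => w p * planck (t * g p)) P := by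
  refine (hI.const_mul t⁻¹).mono'
    (hw.mul (measurable_planck.comp (hg.const_mul t))).aestronglyMeasurable ?_
  filter_upwards [h0] with p hp
  have h1 := planck_le_inv (mul_pos ht hp)
  have h2 := planck_nonneg (mul_pos ht hp).le
  rw [Real.norm_eq_abs, abs_mul, abs_of_nonneg h2, ← mul_inv]
  exact (mul_le_of_le_one_left h2 (hw1 p)).trans h1

theorem integrable_planck (hg : Measurable g) (h0 : ∀ᵐ p ∂P, 0 < g p)
    (hI : Integrable (fun p => (g p)⁻¹) P) {t : ℝ} (ht : 0 < t) :
    Integrable (fun p => planck (t * g p)) P := by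
  simpa using integrable_mul_planck (w := fun _ => 1) hg h0 hI measurable_const (by simp) ht

/-- The bound `t * planck (t * g) ≤ 1 / g` is uniform in `t`, so dominated convergence applies. This
is the regime of large mass. -/
theorem tendsto_mul_integral_mul_planck (hg : Measurable g) (h0 : ∀ᵐ p ∂P, 0 < g p)
    (hI : Integrable (fun p => (g p)⁻¹) P) (hw : Measurable w) (hw1 : ∀ p, |w p| ≤ 1) :
    Tendsto (fun t => t * ∫ p, w p * planck (t * g p) ∂P) (𝓝[>] 0)
      (𝓝 (∫ p, w p * (g p)⁻¹ ∂P)) := by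
  simp_rw [← integral_const_mul]
  refine tendsto_integral_filter_of_dominated_convergence (fun p => (g p)⁻¹) ?_ ?_ hI ?_
  · exact Eventually.of_forall fun t =>
      ((hw.mul (measurable_planck.comp (hg.const_mul t))).const_mul t).aestronglyMeasurable
  · filter_upwards [self_mem_nhdsWithin] with t (ht : 0 < t)
    filter_upwards [h0] with p hp
    have h1 := planck_le_inv (mul_pos ht hp)
    have h2 := planck_nonneg (mul_pos ht hp).le
    rw [Real.norm_eq_abs, abs_mul, abs_mul, abs_of_nonneg h2, abs_of_pos ht]
    calc t * (|w p| * planck (t * g p)) ≤ t * (1 * (t * g p)⁻¹) := by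
          gcongr; exact hw1 p
      _ = (g p)⁻¹ := by field_simp
  · filter_upwards [h0] with p hp
    refine ((tendsto_mul_planck hp).const_mul (w p)).congr fun t => by ring

theorem tendsto_mul_integral_planck (hg : Measurable g) (h0 : ∀ᵐ p ∂P, 0 < g p)
    (hI : Integrable (fun p => (g p)⁻¹) P) :
    Tendsto (fun t => t * ∫ p, planck (t * g p) ∂P) (𝓝[>] 0) (𝓝 (∫ p, (g p)⁻¹ ∂P)) := by
  simpa using
    tendsto_mul_integral_mul_planck (w := fun _ => 1) hg h0 hI measurable_const (by simp)

theorem integral_planck_le (hg : Measurable g) (h0 : ∀ᵐ p ∂P, 0 < g p)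
    (hI : Integrable (fun p => (g p)⁻¹) P) {t : ℝ} (ht : 0 < t) :
    ∫ p, planck (t * g p) ∂P ≤ t⁻¹ * ∫ p, (g p)⁻¹ ∂P := by
  rw [← integral_const_mul]
  refine integral_mono_ae (integrable_planck hg h0 hI ht) (hI.const_mul _) ?_
  filter_upwards [h0] with p hp
  rw [← mul_inv]
  exact planck_le_inv (mul_pos ht hp)

variable [IsFiniteMeasure P]

/-- For parameters above `t / 2`, the bound `planck r ≤ 1 / r` dominates the derivative by a
constant plus a multiple of `1 / g`. The weights `1`, `g` and `1 - g` are the ones needed later. -/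
theorem hasDerivAt_integral_mul_planck (hg : Measurable g) (h0 : ∀ᵐ p ∂P, 0 < g p)
    (hI : Integrable (fun p => (g p)⁻¹) P) (hw : Measurable w) (hw1 : ∀ p, |w p| ≤ 1)
    {t : ℝ} (ht : 0 < t) :
    Integrable (fun p => w p * (-(planck (t * g p) + planck (t * g p) ^ 2) * g p)) P ∧
    HasDerivAt (fun t => ∫ p, w p * planck (t * g p) ∂P)
      (∫ p, w p * (-(planck (t * g p) + planck (t * g p) ^ 2) * g p) ∂P) t := by
  have hm : ∀ t, Measurable fun p => planck (t * g p) := fun t =>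
    measurable_planck.comp (hg.const_mul t)
  refine hasDerivAt_integral_of_dominated_loc_of_deriv_le (s := Ioi (t / 2))
    (F := fun t p => w p * planck (t * g p))
    (F' := fun t p => w p * (-(planck (t * g p) + planck (t * g p) ^ 2) * g p))
    (bound := fun p => (t / 2)⁻¹ + (t / 2)⁻¹ ^ 2 * (g p)⁻¹)
    (Ioi_mem_nhds (by linarith)) (Eventually.of_forall fun s => (hw.mul (hm s)).aestronglyMeasurable)
    (integrable_mul_planck hg h0 hI hw hw1 ht)
    (hw.mul (((hm t).add ((hm t).pow_const 2)).neg.mul hg)).aestronglyMeasurable ?_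
    ((integrable_const _).add (hI.const_mul _)) ?_
  · filter_upwards [h0] with p hp s (hs : t / 2 < s)
    have hs' : 0 < s := by linarith
    have hsg := mul_pos hs' hp
    have h2 := planck_nonneg hsg.le
    have h1 := planck_le_inv hsg
    have h3 : 0 ≤ (planck (s * g p) + planck (s * g p) ^ 2) * g p := by positivity
    rw [Real.norm_eq_abs, abs_mul, neg_mul, abs_neg, abs_of_nonneg h3]
    refine (mul_le_of_le_one_left h3 (hw1 p)).trans ?_
    have h4 : s⁻¹ ≤ (t / 2)⁻¹ := inv_anti₀ (by linarith) hs.le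
    calc (planck (s * g p) + planck (s * g p) ^ 2) * g p
        ≤ ((s * g p)⁻¹ + (s * g p)⁻¹ ^ 2) * g p := by gcongr
      _ = s⁻¹ + s⁻¹ ^ 2 * (g p)⁻¹ := by field_simp
      _ ≤ _ := by gcongr
  · filter_upwards [h0] with p hp s (hs : t / 2 < s)
    have hsg : 0 < s * g p := mul_pos (by linarith) hp
    have h1 : HasDerivAt (fun s => s * g p) (g p) s := by
      simpa using (hasDerivAt_id s).mul_const (g p)
    exact ((hasDerivAt_planck hsg).comp s h1).const_mul (w p)

theorem integral_mul_planck_deriv_neg (hP : P ≠ 0) (hg : Measurable g) (h0 : ∀ᵐ p ∂P, 0 < g p)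
    (hI : Integrable (fun p => (g p)⁻¹) P) (hw : Measurable w) (hw1 : ∀ p, |w p| ≤ 1)
    (hw0 : ∀ᵐ p ∂P, 0 < w p) {t : ℝ} (ht : 0 < t) :
    ∫ p, w p * (-(planck (t * g p) + planck (t * g p) ^ 2) * g p) ∂P < 0 := by
  have h := (hasDerivAt_integral_mul_planck hg h0 hI hw hw1 ht).1
  rw [← neg_pos, ← integral_neg]
  refine integral_pos_of_ae_pos hP ?_ h.neg
  filter_upwards [h0, hw0] with p hp hwp
  have := planck_pos (mul_pos ht hp)
  have : 0 < w p * ((planck (t * g p) + planck (t * g p) ^ 2) * g p) := by positivity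
  linarith

theorem strictAntiOn_integral_mul_planck (hP : P ≠ 0) (hg : Measurable g)
    (h0 : ∀ᵐ p ∂P, 0 < g p) (hI : Integrable (fun p => (g p)⁻¹) P) (hw : Measurable w)
    (hw1 : ∀ p, |w p| ≤ 1) (hw0 : ∀ᵐ p ∂P, 0 < w p) :
    StrictAntiOn (fun t => ∫ p, w p * planck (t * g p) ∂P) (Ioi 0) := by
  refine strictAntiOn_of_deriv_neg (convex_Ioi 0) (fun t ht =>
    (hasDerivAt_integral_mul_planck hg h0 hI hw hw1 ht).2.continuousAt.continuousWithinAt) ?_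
  intro t ht
  rw [interior_Ioi] at ht
  rw [(hasDerivAt_integral_mul_planck hg h0 hI hw hw1 ht).2.deriv]
  exact integral_mul_planck_deriv_neg hP hg h0 hI hw hw1 hw0 ht

/-- As `t → ∞` the density `1 / (e^{t g} - 1)` concentrates where `g` is small. -/
theorem tendsto_integral_planck_ratio (hg : Measurable g) (h0 : ∀ᵐ p ∂P, 0 < g p)
    (hI : Integrable (fun p => (g p)⁻¹) P) (hg1 : ∀ p, |g p| ≤ 1)
    (hsmall : ∀ ε > 0, P {p | g p < ε} ≠ 0) :
    Tendsto (fun t => (∫ p, g p * planck (t * g p) ∂P) / ∫ p, planck (t * g p) ∂P)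
      atTop (𝓝 0) := by
  have hP : P ≠ 0 := fun h => hsmall 1 one_pos (by simp [h])
  have hpos : ∀ t > 0, 0 < ∫ p, planck (t * g p) ∂P := fun t ht =>
    integral_pos_of_ae_pos hP (h0.mono fun p hp => planck_pos (mul_pos ht hp))
      (integrable_planck hg h0 hI ht)
  -- The numerator is cut at `g = ε`, the denominator is bounded below on `{g < ε / 2}`, and `planck
  -- (t ε) / planck (t ε / 2)` decays exponentially in `t`.
  have key : ∀ ε > 0, ∀ t > 0, (∫ p, g p * planck (t * g p) ∂P) / ∫ p, planck (t * g p) ∂P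
      ≤ ε + P.real univ / P.real {p | g p < ε / 2} * (Real.exp (t * (ε / 2)) + 1)⁻¹ := by
    intro ε hε t ht
    set c := P.real {p | g p < ε / 2} with hc
    have hcpos : 0 < c := ENNReal.toReal_pos (hsmall _ (half_pos hε)) (measure_ne_top _ _)
    have hi := integrable_planck hg h0 hI ht
    have hlow : c * planck (t * (ε / 2)) ≤ ∫ p, planck (t * g p) ∂P := by
      have hms : MeasurableSet {p | g p < ε / 2} := measurableSet_lt hg measurable_const
      calc c * planck (t * (ε / 2)) = ∫ p in {p | g p < ε / 2}, planck (t * (ε / 2)) ∂P := by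
            rw [setIntegral_const, smul_eq_mul]
        _ ≤ ∫ p in {p | g p < ε / 2}, planck (t * g p) ∂P := by
            refine setIntegral_mono_on_ae (integrable_const _).integrableOn hi.integrableOn hms ?_
            filter_upwards [h0] with p hp hps
            exact planck_le_planck (mul_pos ht hp) (mul_le_mul_of_nonneg_left (le_of_lt hps) ht.le)
        _ ≤ _ := setIntegral_le_integral hi (h0.mono fun p hp => planck_nonneg (mul_pos ht hp).le)
    have hup : ∫ p, g p * planck (t * g p) ∂P ≤
        ε * ∫ p, planck (t * g p) ∂P + P.real univ * planck (t * ε) := by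
      calc ∫ p, g p * planck (t * g p) ∂P ≤ ∫ p, (ε * planck (t * g p) + planck (t * ε)) ∂P := by
            refine integral_mono_ae (integrable_mul_planck hg h0 hI hg hg1 ht)
              ((hi.const_mul _).add (integrable_const _)) ?_
            filter_upwards [h0] with p hp
            have h2 := planck_nonneg (mul_pos ht hp).le
            have h3 := planck_nonneg (mul_pos ht hε).le
            rcases le_total (g p) ε with h | h
            · have := mul_le_mul_of_nonneg_right h h2
              linarith
            · have h4 := planck_le_planck (mul_pos ht hε) (mul_le_mul_of_nonneg_left h ht.le)
              have h5 := mul_le_of_le_one_left h2 ((le_abs_self _).trans (hg1 p))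
              have : 0 ≤ ε * planck (t * g p) := by positivity
              linarith
        _ = _ := by
            rw [integral_add (hi.const_mul _) (integrable_const _), integral_const_mul]
            simp
    rw [div_le_iff₀ (hpos t ht), add_mul]
    refine hup.trans (add_le_add le_rfl ?_)
    have he : planck (t * ε) = (Real.exp (t * (ε / 2)) + 1)⁻¹ * planck (t * (ε / 2)) := by
      unfold planck
      rw [← mul_inv]
      congr 1
      have : Real.exp (t * ε) = Real.exp (t * (ε / 2)) * Real.exp (t * (ε / 2)) := by
        rw [← Real.exp_add]; ring_nf
      rw [this]; ring
    have hE : 0 < Real.exp (t * (ε / 2)) + 1 := by positivity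
    calc P.real univ * planck (t * ε)
        = P.real univ / c * (Real.exp (t * (ε / 2)) + 1)⁻¹ * (c * planck (t * (ε / 2))) := by
          rw [he]; field_simp
      _ ≤ _ := by gcongr
  rw [Metric.tendsto_atTop']
  intro ε hε
  have hlim : Tendsto (fun t => ε / 2 + P.real univ / P.real {p | g p < ε / 2 / 2} *
      (Real.exp (t * (ε / 2 / 2)) + 1)⁻¹) atTop (𝓝 (ε / 2 + P.real univ /
      P.real {p | g p < ε / 2 / 2} * 0)) := by
    refine tendsto_const_nhds.add (tendsto_const_nhds.mul (Tendsto.inv_tendsto_atTop ?_))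
    exact tendsto_atTop_add_const_right _ _ (Real.tendsto_exp_atTop.comp
      (tendsto_id.atTop_mul_const (by positivity)))
  rw [mul_zero, add_zero] at hlim
  obtain ⟨N, hN⟩ := (((hlim.eventually_lt_const (half_lt_self hε)).and
    (eventually_gt_atTop 0))).exists_forall_of_atTop
  refine ⟨N, fun t ht => ?_⟩
  obtain ⟨h1, h2⟩ := hN t ht.le
  have h3 : 0 ≤ ∫ p, g p * planck (t * g p) ∂P := by
    refine integral_nonneg_of_ae ?_
    filter_upwards [h0] with p hp
    exact mul_nonneg hp.le (planck_nonneg (mul_pos h2 hp).le)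
  rw [Real.dist_eq, sub_zero, abs_of_nonneg (div_nonneg h3 (hpos t h2).le)]
  exact (key _ (half_pos hε) t h2).trans_lt h1

/-- Chebyshev's inequality: the density `1 / (e^{t g} - 1)` favours small values of `g`. -/
theorem integral_mul_planck_lt_average (hg : Measurable g) (h0 : ∀ᵐ p ∂P, 0 < g p)
    (hI : Integrable (fun p => (g p)⁻¹) P) (hg1 : ∀ p, |g p| ≤ 1)
    (hsmall : ∀ ε > 0, P {p | g p < ε} ≠ 0) {t : ℝ} (ht : 0 < t) :
    ∫ p, g p * planck (t * g p) ∂P <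
      (∫ p, planck (t * g p) ∂P) * ((∫ p, g p ∂P) / P.real univ) := by
  have hP : P ≠ 0 := fun h => hsmall 1 one_pos (by simp [h])
  have hgi : Integrable g P :=
    (integrable_const (1 : ℝ)).mono' hg.aestronglyMeasurable (Eventually.of_forall hg1)
  have hK : 0 < P.real univ :=
    ENNReal.toReal_pos (Measure.measure_univ_ne_zero.2 hP) (measure_ne_top _ _)
  set m := (∫ p, g p ∂P) / P.real univ with hm
  have hmpos : 0 < m := div_pos (integral_pos_of_ae_pos hP h0 hgi) hK
  have hi := integrable_planck hg h0 hI ht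
  have hgp := integrable_mul_planck hg h0 hI hg hg1 ht
  -- The added term integrates to zero because `m` is the mean of `g`. It turns the integrand into a
  -- product of two factors of equal sign.
  have hii : Integrable (fun p => (m * planck (t * g p) - g p * planck (t * g p))
      + (g p - m) * planck (t * m)) P :=
    ((hi.const_mul m).sub hgp).add ((hgi.sub (integrable_const m)).mul_const _)
  have heq : ∀ p, (m * planck (t * g p) - g p * planck (t * g p)) + (g p - m) * planck (t * m) =
      (m - g p) * (planck (t * g p) - planck (t * m)) := fun p => by ring
  have hpos : 0 < ∫ p, ((m * planck (t * g p) - g p * planck (t * g p))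
      + (g p - m) * planck (t * m)) ∂P := by
    rw [integral_pos_iff_support_of_nonneg_ae _ hii]
    · refine (bot_lt_iff_ne_bot.2 ?_ : (0 : ℝ≥0∞) < _)
      intro h
      refine hsmall m hmpos (measure_mono_null_ae ?_ h)
      filter_upwards [h0] with p hp hpm
      refine Function.mem_support.2 ?_
      rw [heq]
      exact (mul_pos (sub_pos.2 hpm) (sub_pos.2 (planck_lt_planck (mul_pos ht hp)
        (mul_lt_mul_of_pos_left hpm ht)))).ne'
    · filter_upwards [h0] with p hp
      rw [Pi.zero_apply, heq]
      rcases le_total (g p) m with h | h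
      · exact mul_nonneg (sub_nonneg.2 h) (sub_nonneg.2 (planck_le_planck (mul_pos ht hp)
          (mul_le_mul_of_nonneg_left h ht.le)))
      · exact mul_nonneg_of_nonpos_of_nonpos (sub_nonpos.2 h) (sub_nonpos.2
          (planck_le_planck (mul_pos ht hmpos) (mul_le_mul_of_nonneg_left h ht.le)))
  have hsplit : ∫ p, ((m * planck (t * g p) - g p * planck (t * g p))
      + (g p - m) * planck (t * m)) ∂P = m * ∫ p, planck (t * g p) ∂P -
        ∫ p, g p * planck (t * g p) ∂P + (∫ p, g p ∂P - P.real univ * m) * planck (t * m) := by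
    have e1 := integral_add ((hi.const_mul m).sub hgp)
      ((hgi.sub (integrable_const m)).mul_const (planck (t * m)))
    have e2 := integral_sub (hi.const_mul m) hgp
    have e3 := integral_sub hgi (integrable_const (μ := P) m)
    simp only [Pi.sub_apply] at e1 e2 e3
    rw [e1, e2, integral_mul_const, e3, integral_const_mul, integral_const, smul_eq_mul]
  rw [hsplit] at hpos
  have : ∫ p, g p ∂P - P.real univ * m = 0 := by rw [hm]; field_simp; ring
  rw [this] at hpos
  linarith

end Weighted

/-! ### Boundary curves as functions of the mass -/

/-- A strictly antitone surjection `N` of `(0, ∞)` onto itself with nonvanishing derivative has a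
differentiable inverse. -/
theorem hasDerivAt_of_strictAntiOn_rightInverse {N T : ℝ → ℝ} {N' y : ℝ}
    (hN : StrictAntiOn N (Ioi 0)) (hNpos : ∀ t > 0, 0 < N t) (hT : ∀ y > 0, 0 < T y)
    (hNT : ∀ y > 0, N (T y) = y) (hy : 0 < y) (hd : HasDerivAt N N' (T y)) (hN' : N' ≠ 0) :
    HasDerivAt T N'⁻¹ y := by
  -- Reflecting the argument makes `T` increasing; a monotone function whose image is a
  -- neighbourhood is continuous.
  have hmono : StrictMonoOn (fun z => T (-z)) (Iio 0) := by
    intro z hz z' hz' hzz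
    have h1 : 0 < -z := neg_pos.2 hz
    have h2 : 0 < -z' := neg_pos.2 hz'
    rw [← hN.lt_iff_gt (hT _ h2) (hT _ h1), hNT _ h1, hNT _ h2]
    exact neg_lt_neg hzz
  have himg : (fun z => T (-z)) '' Iio 0 ∈ 𝓝 (T (- -y)) := by
    rw [neg_neg]
    refine mem_of_superset (Ioi_mem_nhds (hT y hy)) fun t (ht : 0 < t) =>
      ⟨-N t, neg_neg_of_pos (hNpos t ht), ?_⟩
    simp only [neg_neg]
    exact hN.injOn (hT _ (hNpos t ht)) ht (hNT _ (hNpos t ht))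
  have hc := hmono.continuousAt_of_image_mem_nhds (Iio_mem_nhds (neg_neg_of_pos hy)) himg
  have hc' : ContinuousAt T y := by
    have := hc.comp (continuous_neg.continuousAt (x := y))
    simpa [Function.comp_def] using this
  exact hd.of_local_left_inverse hc' hN' (by
    filter_upwards [Ioi_mem_nhds hy] with z hz using hNT z hz)

section Boundary

variable {X : Type*} [MeasurableSpace X] {P : Measure X} {g : X → ℝ}

theorem tendsto_integral_planck_zero (hg : Measurable g) (h0 : ∀ᵐ p ∂P, 0 < g p)
    (hI : Integrable (fun p => (g p)⁻¹) P) :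
    Tendsto (fun t => ∫ p, planck (t * g p) ∂P) atTop (𝓝 0) := by
  have h : Tendsto (fun t : ℝ => t⁻¹ * ∫ p, (g p)⁻¹ ∂P) atTop (𝓝 0) := by
    simpa using tendsto_inv_atTop_zero.mul_const (∫ p, (g p)⁻¹ ∂P)
  refine squeeze_zero' ?_ ?_ h
  · filter_upwards [eventually_gt_atTop 0] with t ht
    exact integral_nonneg_of_ae (h0.mono fun p hp => planck_nonneg (mul_pos ht hp).le)
  · filter_upwards [eventually_gt_atTop 0] with t ht
    exact integral_planck_le hg h0 hI ht

theorem tendsto_integral_planck_atTop (hP : P ≠ 0) (hg : Measurable g) (h0 : ∀ᵐ p ∂P, 0 < g p)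
    (hI : Integrable (fun p => (g p)⁻¹) P) :
    Tendsto (fun t => ∫ p, planck (t * g p) ∂P) (𝓝[>] 0) atTop := by
  have hpos : 0 < ∫ p, (g p)⁻¹ ∂P :=
    integral_pos_of_ae_pos hP (h0.mono fun p hp => inv_pos.2 hp) hI
  refine ((tendsto_mul_integral_planck hg h0 hI).pos_mul_atTop hpos
    tendsto_inv_nhdsGT_zero).congr' ?_
  filter_upwards [self_mem_nhdsWithin] with t (ht : 0 < t)
  field_simp

variable [IsFiniteMeasure P]

theorem hasDerivAt_integral_planck (hg : Measurable g) (h0 : ∀ᵐ p ∂P, 0 < g p)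
    (hI : Integrable (fun p => (g p)⁻¹) P) {t : ℝ} (ht : 0 < t) :
    HasDerivAt (fun t => ∫ p, planck (t * g p) ∂P)
      (∫ p, 1 * (-(planck (t * g p) + planck (t * g p) ^ 2) * g p) ∂P) t := by
  simpa only [one_mul] using (hasDerivAt_integral_mul_planck (w := fun _ => 1) hg h0 hI
    measurable_const (by simp) ht).2

theorem strictAntiOn_integral_planck (hP : P ≠ 0) (hg : Measurable g)
    (h0 : ∀ᵐ p ∂P, 0 < g p) (hI : Integrable (fun p => (g p)⁻¹) P) :
    StrictAntiOn (fun t => ∫ p, planck (t * g p) ∂P) (Ioi 0) := by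
  simpa only [one_mul] using strictAntiOn_integral_mul_planck (w := fun _ => 1) hP hg h0 hI
    measurable_const (by simp) (by simp)

theorem exists_integral_planck_eq (hP : P ≠ 0) (hg : Measurable g) (h0 : ∀ᵐ p ∂P, 0 < g p)
    (hI : Integrable (fun p => (g p)⁻¹) P) {y : ℝ} (hy : 0 < y) :
    ∃ t > 0, ∫ p, planck (t * g p) ∂P = y :=
  isPreconnected_Ioi.intermediate_value_Ioi (l₁ := atTop) (l₂ := 𝓝[>] 0)
    (le_principal_iff.2 (Ioi_mem_atTop 0)) (le_principal_iff.2 self_mem_nhdsWithin)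
    (fun _ ht =>
      (hasDerivAt_integral_planck hg h0 hI ht).continuousAt.continuousWithinAt)
    (tendsto_integral_planck_zero hg h0 hI) (tendsto_integral_planck_atTop hP hg h0 hI) hy

/-- The excess energy `∫ g dB` of the critical equilibria `B = 1 / (e^{t g} - 1)`, as a function
of their mass; it vanishes identically when there are none, that is when `∫ 1/g = ∞`. -/
structure IsBoundaryFunction (P : Measure X) (g : X → ℝ) (F : ℝ → ℝ) : Prop where
  zero : F 0 = 0
  curve : ∫⁻ p, (ENNReal.ofReal (g p))⁻¹ ∂P < ∞ → ∀ t > 0,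
    0 < ∫ p, planck (t * g p) ∂P ∧
      F (∫ p, planck (t * g p) ∂P) = ∫ p, g p * planck (t * g p) ∂P
  surj : ∫⁻ p, (ENNReal.ofReal (g p))⁻¹ ∂P < ∞ → ∀ y > 0, ∃ t > 0,
    ∫ p, planck (t * g p) ∂P = y
  eq_zero : ∫⁻ p, (ENNReal.ofReal (g p))⁻¹ ∂P = ∞ → F = 0
  differentiableOn : DifferentiableOn ℝ F (Ici 0)
  monotoneOn : MonotoneOn F (Ici 0)
  strictMonoOn : ∫⁻ p, (ENNReal.ofReal (g p))⁻¹ ∂P < ∞ → StrictMonoOn F (Ici 0)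
  strictMonoOn_sub : (∀ᵐ p ∂P, g p < 1) → StrictMonoOn (fun x => x - F x) (Ici 0)
  tendsto_div : Tendsto (fun y => F y / y) atTop
    (𝓝 (P.real univ * ((∫⁻ p, (ENNReal.ofReal (g p))⁻¹ ∂P)⁻¹).toReal))
  lt_average : ∀ y > 0, F y < y * ((∫ p, g p ∂P) / P.real univ)

theorem strictMonoOn_Ici_of_Ioi {F : ℝ → ℝ} (h : StrictMonoOn F (Ioi 0))
    (h0 : ∀ y > 0, F 0 < F y) : StrictMonoOn F (Ici 0) := by
  intro x hx y _ hxy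
  rcases (show (0 : ℝ) ≤ x from hx).eq_or_lt with rfl | hx'
  · exact h0 y hxy
  · exact h hx' (hx'.trans hxy) hxy

/-- With mass `N` and excess energy `G` as functions of `t`, take `F = G ∘ N⁻¹`. Both are strictly
decreasing, so `F` increases; small mass corresponds to `t → ∞` and large mass to `t → 0`. -/
theorem exists_isBoundaryFunction_of_lt_top (hg : Measurable g) (h0 : ∀ᵐ p ∂P, 0 < g p)
    (hgI : ∀ p, g p ∈ Icc (0 : ℝ) 1) (hsmall : ∀ ε > 0, P {p | g p < ε} ≠ 0)
    (hfin : ∫⁻ p, (ENNReal.ofReal (g p))⁻¹ ∂P < ∞) :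
    ∃ F : ℝ → ℝ, IsBoundaryFunction P g F := by
  have hP : P ≠ 0 := fun h => hsmall 1 one_pos (by simp [h])
  have hI := integrable_inv_of_lintegral hg h0 hfin
  have hg1 : ∀ p, |g p| ≤ 1 := fun p => abs_le.2 ⟨by linarith [(hgI p).1], (hgI p).2⟩
  set N : ℝ → ℝ := fun t => ∫ p, planck (t * g p) ∂P with hN
  set G : ℝ → ℝ := fun t => ∫ p, g p * planck (t * g p) ∂P with hG
  have hNpos : ∀ t > 0, 0 < N t := fun t ht =>
    integral_pos_of_ae_pos hP (h0.mono fun p hp => planck_pos (mul_pos ht hp))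
      (integrable_planck hg h0 hI ht)
  have hGpos : ∀ t > 0, 0 < G t := fun t ht =>
    integral_pos_of_ae_pos hP (h0.mono fun p hp => mul_pos hp (planck_pos (mul_pos ht hp)))
      (integrable_mul_planck hg h0 hI hg hg1 ht)
  have hanti : StrictAntiOn N (Ioi 0) := strictAntiOn_integral_planck hP hg h0 hI
  have hGanti : StrictAntiOn G (Ioi 0) := strictAntiOn_integral_mul_planck hP hg h0 hI hg hg1 h0
  have hsurj : ∀ y : ℝ, ∃ t, 0 < y → 0 < t ∧ N t = y := fun y => by
    by_cases hy : 0 < y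
    · obtain ⟨t, ht, h⟩ := exists_integral_planck_eq hP hg h0 hI hy
      exact ⟨t, fun _ => ⟨ht, h⟩⟩
    · exact ⟨0, fun h => absurd h hy⟩
  choose T hT using hsurj
  have hTpos : ∀ y > 0, 0 < T y := fun y hy => (hT y hy).1
  have hNT : ∀ y > 0, N (T y) = y := fun y hy => (hT y hy).2
  have hTN : ∀ t > 0, T (N t) = t := fun t ht =>
    hanti.injOn (hTpos _ (hNpos t ht)) ht (hNT _ (hNpos t ht))
  have hTanti : StrictAntiOn T (Ioi 0) := fun x hx y hy hxy => by
    rw [← hanti.lt_iff_gt (hTpos x hx) (hTpos y hy), hNT x hx, hNT y hy]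
    exact hxy
  set F : ℝ → ℝ := fun y => if 0 < y then G (T y) else 0 with hF
  have hF0 : F 0 = 0 := if_neg (lt_irrefl 0)
  have hFpos : ∀ y > 0, F y = G (T y) := fun y hy => if_pos hy
  have hFN : ∀ t > 0, F (N t) = G t := fun t ht => by rw [hFpos _ (hNpos t ht), hTN t ht]
  have hFmono : StrictMonoOn F (Ici 0) := by
    refine strictMonoOn_Ici_of_Ioi (fun x hx y hy hxy => ?_) fun y hy => ?_
    · rw [hFpos x hx, hFpos y hy]
      exact hGanti (hTpos y hy) (hTpos x hx) (hTanti hx hy hxy)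
    · rw [hF0, hFpos y hy]
      exact hGpos _ (hTpos y hy)
  refine ⟨F, hF0, fun _ t ht => ⟨hNpos t ht, hFN t ht⟩,
    fun _ y hy => ⟨T y, hTpos y hy, hNT y hy⟩, fun h => absurd h hfin.ne, ?_,
    hFmono.monotoneOn, fun _ => hFmono, ?_, ?_, ?_⟩
  · intro y hy
    rcases (show (0 : ℝ) ≤ y from hy).eq_or_lt with rfl | hy'
    -- The slope `F y / y` is the ratio `G / N` at `T y → ∞`, where the density concentrates on
    -- small `g`; hence the derivative at the origin is zero.
    · have : HasDerivWithinAt F 0 (Ici 0) 0 := by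
        rw [hasDerivWithinAt_iff_tendsto_slope, Ici_sdiff_left]
        have hTtop : Tendsto T (𝓝[>] 0) atTop := by
          refine tendsto_atTop.2 fun R => ?_
          have hR : (0 : ℝ) < max R 1 := lt_max_of_lt_right one_pos
          filter_upwards [Ioo_mem_nhdsGT (hNpos _ hR)] with y hy
          refine (le_max_left R 1).trans ?_
          rw [← hTN _ hR]
          exact (hTanti hy.1 (hNpos _ hR) hy.2).le
        refine ((tendsto_integral_planck_ratio hg h0 hI hg1 hsmall).comp hTtop).congr' ?_
        filter_upwards [self_mem_nhdsWithin] with y (hy : 0 < y)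
        change G (T y) / N (T y) = _
        rw [slope_def_field, hF0, hFpos y hy, hNT y hy, sub_zero, sub_zero]
      exact this.differentiableWithinAt
    · have h1 := hasDerivAt_of_strictAntiOn_rightInverse hanti hNpos hTpos hNT hy'
        (hasDerivAt_integral_planck hg h0 hI (hTpos y hy'))
        (integral_mul_planck_deriv_neg hP hg h0 hI measurable_const (by simp) (by simp)
          (hTpos y hy')).ne
      have h2 := (hasDerivAt_integral_mul_planck hg h0 hI hg hg1 (hTpos y hy')).2.comp y h1
      refine DifferentiableAt.differentiableWithinAt
        (h2.differentiableAt.congr_of_eventuallyEq ?_)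
      filter_upwards [Ioi_mem_nhds hy'] with z hz using hFpos z hz
  · intro hlt
    have hw : Measurable fun p => 1 - g p := measurable_const.sub hg
    have hw1 : ∀ p, |1 - g p| ≤ 1 := fun p =>
      abs_le.2 ⟨by linarith [(hgI p).2], by linarith [(hgI p).1]⟩
    have hw0 : ∀ᵐ p ∂P, 0 < 1 - g p := hlt.mono fun p hp => sub_pos.2 hp
    -- The same monotonicity argument now runs with weight `1 - g` in place of `g`.
    have hE : ∀ y > 0, y - F y = ∫ p, (1 - g p) * planck (T y * g p) ∂P := fun y hy => by
      have ht := hTpos y hy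
      rw [hFpos y hy]
      nth_rewrite 1 [← hNT y hy]
      rw [hN, hG, ← integral_sub (integrable_planck hg h0 hI ht)
        (integrable_mul_planck hg h0 hI hg hg1 ht)]
      exact integral_congr_ae (Eventually.of_forall fun p => by ring)
    refine strictMonoOn_Ici_of_Ioi (fun x hx y hy hxy => ?_) fun y hy => ?_
    · simp only [hE x hx, hE y hy]
      exact strictAntiOn_integral_mul_planck hP hg h0 hI hw hw1 hw0 (hTpos y hy) (hTpos x hx)
        (hTanti hx hy hxy)
    · simp only [hE y hy, hF0, sub_zero]
      refine integral_pos_of_ae_pos hP ?_ (integrable_mul_planck hg h0 hI hw hw1 (hTpos y hy))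
      filter_upwards [h0, hw0] with p hp hwp
      exact mul_pos hwp (planck_pos (mul_pos (hTpos y hy) hp))
  · have hIpos : 0 < ∫ p, (g p)⁻¹ ∂P :=
      integral_pos_of_ae_pos hP (h0.mono fun p hp => inv_pos.2 hp) hI
    have hTzero : Tendsto T atTop (𝓝[>] 0) := by
      refine tendsto_nhdsWithin_iff.2 ⟨?_, (eventually_gt_atTop 0).mono hTpos⟩
      have h : Tendsto (fun y : ℝ => y⁻¹ * ∫ p, (g p)⁻¹ ∂P) atTop (𝓝 0) := by
        simpa using tendsto_inv_atTop_zero.mul_const (∫ p, (g p)⁻¹ ∂P)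
      refine squeeze_zero' ((eventually_gt_atTop 0).mono fun y hy => (hTpos y hy).le) ?_ h
      filter_upwards [eventually_gt_atTop 0] with y hy
      have h1 := integral_planck_le hg h0 hI (hTpos y hy)
      have h2 : y ≤ (T y)⁻¹ * ∫ p, (g p)⁻¹ ∂P := (hNT y hy).ge.trans h1
      have h3 := hTpos y hy
      field_simp at h2 ⊢
      linarith
    -- Multiplying both `G` and `N` by `t = T y → 0` gives the limits `∫ g * g⁻¹`, which is the
    -- total volume, and `∫ g⁻¹`.
    have hlim := ((tendsto_mul_integral_mul_planck hg h0 hI hg hg1).div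
      (tendsto_mul_integral_planck hg h0 hI) hIpos.ne').comp hTzero
    have hK : ∫ p, g p * (g p)⁻¹ ∂P = P.real univ := by
      rw [integral_congr_ae (g := fun _ => (1 : ℝ))
        (h0.mono fun p hp => mul_inv_cancel₀ hp.ne')]
      simp
    rw [hK, integral_inv_eq_toReal hg h0] at hlim
    rw [ENNReal.toReal_inv, ← div_eq_mul_inv]
    refine hlim.congr' ?_
    filter_upwards [eventually_gt_atTop 0] with y hy
    change T y * G (T y) / (T y * N (T y)) = _
    rw [mul_div_mul_left _ _ (hTpos y hy).ne', hFpos y hy, hNT y hy]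
  · intro y hy
    have := integral_mul_planck_lt_average hg h0 hI hg1 hsmall (hTpos y hy)
    rw [hFpos y hy]
    exact this.trans_eq (by rw [show ∫ p, planck (T y * g p) ∂P = y from hNT y hy])

theorem exists_isBoundaryFunction (hg : Measurable g) (h0 : ∀ᵐ p ∂P, 0 < g p)
    (hgI : ∀ p, g p ∈ Icc (0 : ℝ) 1) (hsmall : ∀ ε > 0, P {p | g p < ε} ≠ 0) :
    ∃ F : ℝ → ℝ, IsBoundaryFunction P g F := by
  by_cases hfin : ∫⁻ p, (ENNReal.ofReal (g p))⁻¹ ∂P < ∞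
  · exact exists_isBoundaryFunction_of_lt_top hg h0 hgI hsmall hfin
  have hP : P ≠ 0 := fun h => hsmall 1 one_pos (by simp [h])
  have hgi : Integrable g P := (integrable_const (1 : ℝ)).mono' hg.aestronglyMeasurable
    (Eventually.of_forall fun p => abs_le.2 ⟨by linarith [(hgI p).1], (hgI p).2⟩)
  refine ⟨0, rfl, fun h => absurd h hfin, fun h => absurd h hfin, fun _ => rfl,
    differentiableOn_const 0, monotoneOn_const, fun h => absurd h hfin, fun _ x _ y _ hxy => ?_,
    ?_, fun y hy => ?_⟩
  · simpa using hxy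
  · simp [not_lt_top_iff.1 hfin]
  · have hK : 0 < P.real univ :=
      ENNReal.toReal_pos (Measure.measure_univ_ne_zero.2 hP) (measure_ne_top _ _)
    have := integral_pos_of_ae_pos hP h0 hgi
    rw [Pi.zero_apply]
    positivity

end Boundary

/-! ### Extended Bose density and free energy density -/

/-- The Bose-Einstein density `1 / (e^s - 1)`, with value `∞` for `s ≤ 0`. -/
noncomputable def boseDensity (s : ℝ) : ℝ≥0∞ := (ENNReal.ofReal (Real.exp s - 1))⁻¹

theorem continuous_boseDensity : Continuous boseDensity := by
  unfold boseDensity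
  exact (ENNReal.continuous_ofReal.comp (by fun_prop)).inv

theorem boseDensity_of_pos {s : ℝ} (hs : 0 < s) : boseDensity s = ENNReal.ofReal (planck s) :=
  (ENNReal.ofReal_inv_of_pos (exp_sub_one_pos hs)).symm

theorem boseDensity_zero : boseDensity 0 = ∞ := by simp [boseDensity]

theorem toReal_boseDensity {s : ℝ} (hs : 0 ≤ s) : (boseDensity s).toReal = planck s := by
  rw [boseDensity, ENNReal.toReal_inv, ENNReal.toReal_ofReal, planck]
  linarith [Real.add_one_le_exp s]

/-- The free energy density `-ln (1 - e^{-s})`, with value `∞` for `s ≤ 0`. Its derivative is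
`-1 / (e^s - 1)`. -/
noncomputable def dualPotential (s : ℝ) : ℝ≥0∞ :=
  (-ENNReal.log (ENNReal.ofReal (1 - Real.exp (-s)))).toENNReal

theorem continuous_dualPotential : Continuous dualPotential :=
  EReal.continuous_toENNReal.comp (continuous_neg.comp
    (ENNReal.continuous_log.comp (ENNReal.continuous_ofReal.comp (by fun_prop))))

theorem dualPotential_zero : dualPotential 0 = ∞ := by simp [dualPotential]

theorem one_sub_exp_neg_pos {s : ℝ} (hs : 0 < s) : 0 < 1 - Real.exp (-s) := by
  simpa using hs

theorem dualPotential_of_pos {s : ℝ} (hs : 0 < s) :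
    dualPotential s = ENNReal.ofReal (-Real.log (1 - Real.exp (-s))) := by
  rw [dualPotential, ENNReal.log_ofReal_of_pos (one_sub_exp_neg_pos hs), ← EReal.coe_neg,
    EReal.toENNReal_of_ne_top (EReal.coe_ne_top _), EReal.toReal_coe]

theorem neg_log_one_sub_exp_neg_nonneg {s : ℝ} (hs : 0 < s) :
    0 ≤ -Real.log (1 - Real.exp (-s)) :=
  neg_nonneg.2 (Real.log_nonpos (one_sub_exp_neg_pos hs).le (by linarith [Real.exp_pos (-s)]))

theorem one_sub_exp_neg_div (s : ℝ) {r : ℝ} (hr : 0 < r) :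
    (1 - Real.exp (-s)) / (1 - Real.exp (-r)) - 1 = planck r * (1 - Real.exp (r - s)) := by
  have h1 := exp_sub_one_pos hr
  have h2 : 1 - (Real.exp r)⁻¹ = (Real.exp r - 1) / Real.exp r := by field_simp
  have := Real.exp_pos s
  rw [Real.exp_neg, Real.exp_neg, Real.exp_sub, planck, h2]
  field_simp
  ring

/-- Convexity: the graph lies above its tangent at `r`. The additive form avoids truncated
subtraction. The proof combines `log x ≤ x - 1` with `1 + x ≤ exp x`. -/
theorem dualPotential_add_le {s r : ℝ} (hs : 0 ≤ s) (hsr : s ≤ r) :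
    dualPotential r + boseDensity r * ENNReal.ofReal (r - s) ≤ dualPotential s := by
  rcases hs.eq_or_lt with rfl | hs
  · simp [dualPotential_zero]
  have hr := hs.trans_le hsr
  have h1 := one_sub_exp_neg_pos hs
  have h2 := one_sub_exp_neg_pos hr
  have h3 := planck_nonneg hr.le
  have h4 : 0 ≤ r - s := sub_nonneg.2 hsr
  rw [dualPotential_of_pos hr, dualPotential_of_pos hs, boseDensity_of_pos hr,
    ← ENNReal.ofReal_mul h3,
    ← ENNReal.ofReal_add (neg_log_one_sub_exp_neg_nonneg hr) (mul_nonneg h3 h4)]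
  refine ENNReal.ofReal_le_ofReal ?_
  have h5 := Real.log_le_sub_one_of_pos (div_pos h1 h2)
  rw [Real.log_div h1.ne' h2.ne'] at h5
  rw [one_sub_exp_neg_div _ hr] at h5
  have h7 := mul_le_mul_of_nonneg_left (Real.add_one_le_exp (r - s)) h3
  nlinarith

/-- The companion tangent inequality, at the left endpoint `s`. At `s = 0` the infinite slope makes
it trivial unless `r = 0`. -/
theorem dualPotential_le_add {s r : ℝ} (hs : 0 ≤ s) (hsr : s ≤ r) :
    dualPotential s ≤ dualPotential r + boseDensity s * ENNReal.ofReal (r - s) := by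
  rcases hs.eq_or_lt with rfl | hs
  · rcases hsr.eq_or_lt with rfl | hr
    · exact le_self_add
    · rw [boseDensity_zero, ENNReal.top_mul (by simpa using hr)]
      simp
  have hr := hs.trans_le hsr
  have h1 := one_sub_exp_neg_pos hs
  have h2 := one_sub_exp_neg_pos hr
  have h3 := planck_nonneg hs.le
  have h4 : 0 ≤ r - s := sub_nonneg.2 hsr
  rw [dualPotential_of_pos hr, dualPotential_of_pos hs, boseDensity_of_pos hs,
    ← ENNReal.ofReal_mul h3,
    ← ENNReal.ofReal_add (neg_log_one_sub_exp_neg_nonneg hr) (mul_nonneg h3 h4)]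
  refine ENNReal.ofReal_le_ofReal ?_
  have h5 := Real.log_le_sub_one_of_pos (div_pos h2 h1)
  rw [Real.log_div h2.ne' h1.ne'] at h5
  rw [one_sub_exp_neg_div _ hs] at h5
  have h7 := mul_le_mul_of_nonneg_left (Real.add_one_le_exp (s - r)) h3
  nlinarith

/-! ### The dual functional and its optimality conditions -/

section Dual

variable {X : Type*} [MeasurableSpace X] {P : Measure X} {s u v : X → ℝ}

/-- A first-order condition for outward moves. The tangent inequality at `s + h u` bounds the
integral for each `h > 0`, and Fatou's lemma passes to `h → 0`. -/
theorem lintegral_boseDensity_mul_le (hs : Measurable s) (hu : Measurable u)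
    (hs0 : ∀ p, 0 ≤ s p) (hu0 : ∀ p, 0 ≤ u p) {U : ℝ}
    (hfin : ∫⁻ p, dualPotential (s p) ∂P ≠ ∞)
    (hmin : ∀ h > 0, ∫⁻ p, dualPotential (s p) ∂P ≤
      ∫⁻ p, dualPotential (s p + h * u p) ∂P + ENNReal.ofReal (h * U)) :
    ∫⁻ p, boseDensity (s p) * ENNReal.ofReal (u p) ∂P ≤ ENNReal.ofReal U := by
  have hm : ∀ h, Measurable fun p => boseDensity (s p + h * u p) * ENNReal.ofReal (u p) :=
    fun h => (continuous_boseDensity.measurable.comp (hs.add (hu.const_mul h))).mul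
      hu.ennreal_ofReal
  have hmφ : ∀ h, Measurable fun p => dualPotential (s p + h * u p) := fun h =>
    continuous_dualPotential.measurable.comp (hs.add (hu.const_mul h))
  have key : ∀ h > 0, ∫⁻ p, boseDensity (s p + h * u p) * ENNReal.ofReal (u p) ∂P
      ≤ ENNReal.ofReal U := by
    intro h hh
    have h1 : ∫⁻ p, dualPotential (s p + h * u p) ∂P + ENNReal.ofReal h *
        ∫⁻ p, boseDensity (s p + h * u p) * ENNReal.ofReal (u p) ∂P
        ≤ ∫⁻ p, dualPotential (s p) ∂P := by
      rw [← lintegral_const_mul _ (hm h), ← lintegral_add_left (hmφ h)]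
      refine lintegral_mono fun p => ?_
      refine le_trans (le_of_eq ?_) (dualPotential_add_le (hs0 p)
        (le_add_of_nonneg_right (mul_nonneg hh.le (hu0 p))))
      rw [add_sub_cancel_left, ENNReal.ofReal_mul hh.le]
      ring
    have h2 : ∫⁻ p, dualPotential (s p + h * u p) ∂P ≠ ∞ :=
      ((le_self_add.trans h1).trans_lt hfin.lt_top).ne
    have h3 := (ENNReal.add_le_add_iff_left h2).1 (h1.trans (hmin h hh))
    rw [ENNReal.ofReal_mul hh.le] at h3
    exact (ENNReal.mul_le_mul_iff_right (by simpa using hh) ENNReal.ofReal_ne_top).1 h3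
  have hlim : ∀ p, liminf (fun h => boseDensity (s p + h * u p) * ENNReal.ofReal (u p)) (𝓝[>] 0)
      = boseDensity (s p) * ENNReal.ofReal (u p) := fun p => by
    refine Tendsto.liminf_eq (ENNReal.Tendsto.mul_const ?_ (Or.inr ENNReal.ofReal_ne_top))
    have : Continuous fun h : ℝ => boseDensity (s p + h * u p) :=
      continuous_boseDensity.comp (by fun_prop)
    simpa using this.continuousWithinAt.tendsto (x := (0 : ℝ)) (s := Ioi 0)
  calc ∫⁻ p, boseDensity (s p) * ENNReal.ofReal (u p) ∂P
      = ∫⁻ p, liminf (fun h => boseDensity (s p + h * u p) * ENNReal.ofReal (u p)) (𝓝[>] 0) ∂P :=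
        lintegral_congr fun p => (hlim p).symm
    _ ≤ liminf (fun h => ∫⁻ p, boseDensity (s p + h * u p) * ENNReal.ofReal (u p) ∂P) (𝓝[>] 0) :=
        lintegral_liminf_le hm
    _ ≤ ENNReal.ofReal U := by
        refine liminf_le_of_frequently_le' (Eventually.frequently ?_)
        filter_upwards [self_mem_nhdsWithin] with h hh using key h hh

/-- The reverse condition, for moves that decrease a positive coordinate. For `h < x / 2` one has `s
- h u ≥ (x / 2) u`, so the integrands are dominated by `2 / x`. -/
theorem le_lintegral_boseDensity_mul [IsFiniteMeasure P] (hs : Measurable s) (hu : Measurable u)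
    (hupos : ∀ᵐ p ∂P, 0 < u p) (hu0 : ∀ p, 0 ≤ u p) {x U : ℝ} (hx : 0 < x)
    (hxs : ∀ p, x * u p ≤ s p)
    (hfin : ∫⁻ p, dualPotential (s p) ∂P ≠ ∞)
    (hmin : ∀ h ∈ Ioo 0 x, ∫⁻ p, dualPotential (s p) ∂P + ENNReal.ofReal (h * U) ≤
      ∫⁻ p, dualPotential (s p - h * u p) ∂P) :
    ENNReal.ofReal U ≤ ∫⁻ p, boseDensity (s p) * ENNReal.ofReal (u p) ∂P := by
  have hm : ∀ h, Measurable fun p => boseDensity (s p - h * u p) * ENNReal.ofReal (u p) :=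
    fun h => (continuous_boseDensity.measurable.comp (hs.sub (hu.const_mul h))).mul
      hu.ennreal_ofReal
  have hmφ : Measurable fun p => dualPotential (s p) := continuous_dualPotential.measurable.comp hs
  have key : ∀ h ∈ Ioo 0 x, ENNReal.ofReal U ≤
      ∫⁻ p, boseDensity (s p - h * u p) * ENNReal.ofReal (u p) ∂P := by
    intro h hh
    have h1 : ∫⁻ p, dualPotential (s p - h * u p) ∂P ≤ ∫⁻ p, dualPotential (s p) ∂P +
        ENNReal.ofReal h * ∫⁻ p, boseDensity (s p - h * u p) * ENNReal.ofReal (u p) ∂P := by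
      rw [← lintegral_const_mul _ (hm h), ← lintegral_add_left hmφ]
      refine lintegral_mono fun p => ?_
      have hle : h * u p ≤ x * u p := mul_le_mul_of_nonneg_right hh.2.le (hu0 p)
      refine (dualPotential_le_add (sub_nonneg.2 (hle.trans (hxs p)))
        (sub_le_self _ (mul_nonneg hh.1.le (hu0 p)))).trans (le_of_eq ?_)
      rw [sub_sub_cancel, ENNReal.ofReal_mul hh.1.le]
      ring
    have h3 := (ENNReal.add_le_add_iff_left hfin).1 ((hmin h hh).trans h1)
    rw [ENNReal.ofReal_mul hh.1.le] at h3
    exact (ENNReal.mul_le_mul_iff_right (by simpa using hh.1) ENNReal.ofReal_ne_top).1 h3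
  have hlim : Tendsto (fun h => ∫⁻ p, boseDensity (s p - h * u p) * ENNReal.ofReal (u p) ∂P)
      (𝓝[>] 0) (𝓝 (∫⁻ p, boseDensity (s p) * ENNReal.ofReal (u p) ∂P)) := by
    refine tendsto_lintegral_filter_of_dominated_convergence
      (fun _ => ENNReal.ofReal (2 / x)) (Eventually.of_forall hm) ?_ ?_ ?_
    · filter_upwards [Ioo_mem_nhdsGT (half_pos hx)] with h hh
      filter_upwards [hupos] with p hp
      have h1 : x / 2 * u p ≤ s p - h * u p := by
        have := mul_le_mul_of_nonneg_right hh.2.le hp.le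
        linarith [hxs p]
      have h2 : 0 < x / 2 * u p := mul_pos (half_pos hx) hp
      rw [boseDensity_of_pos (h2.trans_le h1), ← ENNReal.ofReal_mul
        (planck_nonneg (h2.trans_le h1).le)]
      refine ENNReal.ofReal_le_ofReal ?_
      calc planck (s p - h * u p) * u p ≤ (x / 2 * u p)⁻¹ * u p := by
            gcongr
            exact (planck_le_planck h2 h1).trans (planck_le_inv h2)
        _ = 2 / x := by field_simp
    · rw [lintegral_const]
      exact ENNReal.mul_ne_top ENNReal.ofReal_ne_top (measure_ne_top _ _)
    · refine Eventually.of_forall fun p =>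
        ENNReal.Tendsto.mul_const ?_ (Or.inr ENNReal.ofReal_ne_top)
      have : Continuous fun h : ℝ => boseDensity (s p - h * u p) :=
        continuous_boseDensity.comp (by fun_prop)
      simpa using this.continuousWithinAt.tendsto (x := (0 : ℝ)) (s := Ioi 0)
  refine ge_of_tendsto hlim ?_
  filter_upwards [Ioo_mem_nhdsGT hx] with h hh using key h hh

theorem lowerSemicontinuous_lintegral_dualPotential (hu : Measurable u) (hv : Measurable v) :
    LowerSemicontinuous fun z : ℝ × ℝ => ∫⁻ p, dualPotential (z.1 * u p + z.2 * v p) ∂P := by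
  rw [lowerSemicontinuous_iff_le_liminf]
  intro z
  refine le_trans (le_of_eq (lintegral_congr fun p => ?_)) (lintegral_liminf_le
    fun z => continuous_dualPotential.measurable.comp ((hu.const_mul z.1).add (hv.const_mul z.2)))
  have : Continuous fun z : ℝ × ℝ => dualPotential (z.1 * u p + z.2 * v p) :=
    continuous_dualPotential.comp (by fun_prop)
  exact this.continuousAt.tendsto.liminf_eq.symm

/-- The dual functional attains its minimum on the closed quadrant. -/
theorem exists_dual_minimizer [IsFiniteMeasure P] (hP : P ≠ 0) (hu : Measurable u)
    (hv : Measurable v) {c : ℝ} (hc : 0 < c) (huv : ∀ p, u p + v p = c)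
    {U V : ℝ} (hU : 0 < U) (hV : 0 < V) :
    ∃ x y : ℝ, 0 ≤ x ∧ 0 ≤ y ∧ 0 < x + y ∧
      ∫⁻ p, dualPotential (x * u p + y * v p) ∂P ≠ ∞ ∧
      ∀ x' y' : ℝ, 0 ≤ x' → 0 ≤ y' →
        ∫⁻ p, dualPotential (x * u p + y * v p) ∂P + ENNReal.ofReal (x * U + y * V) ≤
        ∫⁻ p, dualPotential (x' * u p + y' * v p) ∂P + ENNReal.ofReal (x' * U + y' * V) := by
  set D : ℝ × ℝ → ℝ≥0∞ := fun z =>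
    ∫⁻ p, dualPotential (z.1 * u p + z.2 * v p) ∂P + ENNReal.ofReal (z.1 * U + z.2 * V) with hD
  have hlsc : LowerSemicontinuous D :=
    (lowerSemicontinuous_lintegral_dualPotential hu hv).add
      (Continuous.lowerSemicontinuous (ENNReal.continuous_ofReal.comp (by fun_prop)))
  have hone : D (1, 1) ≠ ∞ := by
    simp only [hD, one_mul, huv, lintegral_const]
    exact ENNReal.add_ne_top.2 ⟨ENNReal.mul_ne_top (by simp [dualPotential_of_pos hc])
      (measure_ne_top _ _), ENNReal.ofReal_ne_top⟩
  set m := min U V with hm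
  have hmpos : 0 < m := lt_min hU hV
  -- Outside the square of side `R` the linear term alone is at least `R * min U V ≥ D (1, 1)`, so
  -- minimizing over the compact square suffices.
  set R := max 1 ((D (1, 1)).toReal / m) with hR
  have hR0 : 0 < R := lt_max_of_lt_left one_pos
  obtain ⟨z, ⟨hz1, hz2⟩, hz⟩ := (hlsc.lowerSemicontinuousOn _).exists_isMinOn
    (s := Icc (0 : ℝ) R ×ˢ Icc (0 : ℝ) R) ⟨(0, 0), by simp [hR0.le]⟩
    (isCompact_Icc.prod isCompact_Icc)
  have hmin : ∀ x' y' : ℝ, 0 ≤ x' → 0 ≤ y' → D z ≤ D (x', y') := by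
    intro x' y' hx hy
    by_cases hmem : (x', y') ∈ Icc (0 : ℝ) R ×ˢ Icc (0 : ℝ) R
    · exact hz hmem
    · have h11 : ((1 : ℝ), (1 : ℝ)) ∈ Icc (0 : ℝ) R ×ˢ Icc (0 : ℝ) R :=
        ⟨⟨zero_le_one, le_max_left _ _⟩, ⟨zero_le_one, le_max_left _ _⟩⟩
      refine (hz h11).trans ?_
      rw [← ENNReal.ofReal_toReal hone]
      refine (ENNReal.ofReal_le_ofReal ?_).trans le_add_self
      have h1 : (D (1, 1)).toReal ≤ R * m := (div_le_iff₀ hmpos).1 (le_max_right _ _)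
      have h2 : R ≤ x' + y' := by
        by_contra! hlt
        exact hmem ⟨⟨hx, by dsimp only; linarith⟩, ⟨hy, by dsimp only; linarith⟩⟩
      have h3 : x' * m ≤ x' * U := mul_le_mul_of_nonneg_left (min_le_left _ _) hx
      have h4 : y' * m ≤ y' * V := mul_le_mul_of_nonneg_left (min_le_right _ _) hy
      have h5 := mul_le_mul_of_nonneg_right h2 hmpos.le
      dsimp only
      linarith
  have hfin : D z ≠ ∞ := ((hmin 1 1 zero_le_one zero_le_one).trans_lt hone.lt_top).ne
  refine ⟨z.1, z.2, hz1.1, hz2.1, ?_, (ENNReal.add_ne_top.1 hfin).1, hmin⟩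
  -- The origin is excluded because the potential is identically infinite there.
  refine (add_nonneg hz1.1 hz2.1).lt_of_ne fun h => hfin ?_
  have h1 : z.1 = 0 := by linarith [hz1.1, hz2.1]
  have h2 : z.2 = 0 := by linarith [hz1.1, hz2.1]
  simp [hD, h1, h2, dualPotential_zero, ENNReal.top_mul, hP]

/-- The Karush-Kuhn-Tucker conditions in one coordinate: an inequality always, and equality off the
edge `x = 0`. -/
theorem lintegral_boseDensity_mul_of_minimizer [IsFiniteMeasure P] (hu : Measurable u)
    (hv : Measurable v) (hupos : ∀ᵐ p ∂P, 0 < u p) (hu0 : ∀ p, 0 ≤ u p) (hv0 : ∀ p, 0 ≤ v p)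
    {U V x y : ℝ} (hU : 0 ≤ U) (hV : 0 ≤ V) (hx : 0 ≤ x) (hy : 0 ≤ y)
    (hfin : ∫⁻ p, dualPotential (x * u p + y * v p) ∂P ≠ ∞)
    (hmin : ∀ x', 0 ≤ x' →
      ∫⁻ p, dualPotential (x * u p + y * v p) ∂P + ENNReal.ofReal (x * U + y * V) ≤
      ∫⁻ p, dualPotential (x' * u p + y * v p) ∂P + ENNReal.ofReal (x' * U + y * V)) :
    ∫⁻ p, boseDensity (x * u p + y * v p) * ENNReal.ofReal (u p) ∂P ≤ ENNReal.ofReal U ∧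
    (0 < x → ∫⁻ p, boseDensity (x * u p + y * v p) * ENNReal.ofReal (u p) ∂P
      = ENNReal.ofReal U) := by
  have hs : Measurable fun p => x * u p + y * v p := (hu.const_mul x).add (hv.const_mul y)
  have hle := lintegral_boseDensity_mul_le (P := P) (U := U) hs hu
    (fun p => add_nonneg (mul_nonneg hx (hu0 p)) (mul_nonneg hy (hv0 p))) hu0 hfin (by
      intro h hh
      have h1 := hmin (x + h) (by linarith)
      rw [show (x + h) * U + y * V = h * U + (x * U + y * V) by ring,
        ENNReal.ofReal_add (p := h * U) (by positivity) (by positivity), ← add_assoc] at h1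
      have h2 := (ENNReal.add_le_add_iff_right ENNReal.ofReal_ne_top).1 h1
      simpa only [show ∀ p, (x + h) * u p + y * v p = x * u p + y * v p + h * u p
        from fun p => by ring] using h2)
  refine ⟨hle, fun hx' => hle.antisymm (le_lintegral_boseDensity_mul hs hu hupos hu0 hx'
    (fun p => le_add_of_nonneg_right (mul_nonneg hy (hv0 p))) hfin ?_)⟩
  intro h hh
  have h1 := hmin (x - h) (by linarith [hh.2])
  have h0 : 0 ≤ x - h := by linarith [hh.2]
  have hh0 := hh.1.le
  rw [show x * U + y * V = h * U + ((x - h) * U + y * V) by ring,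
    ENNReal.ofReal_add (by positivity) (by positivity), ← add_assoc] at h1
  have h2 := (ENNReal.add_le_add_iff_right ENNReal.ofReal_ne_top).1 h1
  simpa only [show ∀ p, (x - h) * u p + y * v p = x * u p + y * v p - h * u p
    from fun p => by ring] using h2

end Dual

/-! ### Concavity of the entropy density and Gibbs' principle -/

theorem measurable_entropyDensity : Measurable entropyDensity := by
  unfold entropyDensity
  fun_prop

theorem entropyDensity_nonneg {x : ℝ} (hx : 0 ≤ x) : 0 ≤ entropyDensity x := by
  unfold entropyDensity
  rcases hx.eq_or_lt with rfl | hx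
  · simp
  have h1 := Real.log_le_log hx (show x ≤ 1 + x by linarith)
  have h2 := Real.log_nonneg (show (1 : ℝ) ≤ 1 + x by linarith)
  nlinarith

theorem entropyDensity_planck {s : ℝ} (hs : 0 < s) :
    entropyDensity (planck s) = Real.log (1 + planck s) + s * planck s := by
  have hb := planck_pos hs
  have h1 : 1 + planck s = Real.exp s * planck s := by
    have := exp_sub_one_pos hs
    unfold planck
    field_simp
    ring
  have h2 : Real.log (1 + planck s) = s + Real.log (planck s) := by
    rw [h1, Real.log_mul (Real.exp_pos s).ne' hb.ne', Real.log_exp]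
  unfold entropyDensity
  linear_combination planck s * h2

/-- The entropy density lies strictly below its tangents, except at the point of contact. -/
theorem entropyDensity_lt {s x : ℝ} (hs : 0 < s) (hx : 0 ≤ x) (hne : x ≠ planck s) :
    entropyDensity x < entropyDensity (planck s) + s * (x - planck s) := by
  have hb := planck_pos hs
  rw [entropyDensity_planck hs]
  suffices h : entropyDensity x < Real.log (1 + planck s) + s * x by linarith
  -- The density is `ln (1 + x) + x ln ((1 + x) / x)`. One logarithmic inequality is used for each
  -- term; the remainders cancel because `1 / (1 + planck s) = 1 - exp (-s)`.
  have hlog : Real.log (1 + x) - Real.log (1 + planck s) < (1 + x) / (1 + planck s) - 1 := by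
    rw [← Real.log_div (by positivity) (by positivity)]
    refine Real.log_lt_sub_one_of_pos (by positivity) fun h => hne ?_
    rw [div_eq_one_iff_eq (by positivity)] at h
    linarith
  have hsum : Real.exp (-s) + 1 / (1 + planck s) = 1 := by
    have h1 := exp_sub_one_pos hs
    have h2 : 1 + planck s = Real.exp s / (Real.exp s - 1) := by
      unfold planck
      field_simp
      ring
    rw [h2, Real.exp_neg]
    field_simp
    ring
  unfold entropyDensity
  rcases hx.eq_or_lt with rfl | hx
  · simpa using Real.log_pos (by linarith)
  · have h1 := Real.log_le_sub_one_of_pos (show 0 < Real.exp (-s) * ((1 + x) / x) by positivity)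
    rw [Real.log_mul (Real.exp_pos _).ne' (by positivity), Real.log_exp,
      Real.log_div (by positivity) hx.ne'] at h1
    have h2 := mul_le_mul_of_nonneg_left h1 hx.le
    have h3 : x * (Real.exp (-s) * ((1 + x) / x) - 1) = Real.exp (-s) * (1 + x) - x := by
      field_simp
    have h4 : (1 + x) / (1 + planck s) = (1 + x) * (1 - Real.exp (-s)) := by
      linear_combination (1 + x) * hsum
    rw [h3] at h2
    rw [h4] at hlog
    nlinarith

theorem entropyDensity_le {s x : ℝ} (hs : 0 < s) (hx : 0 ≤ x) :
    entropyDensity x ≤ entropyDensity (planck s) + s * (x - planck s) := by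
  by_cases h : x = planck s
  · simp [h]
  · exact (entropyDensity_lt hs hx h).le

section Gibbs

variable {X : Type*} [MeasurableSpace X] {P : Measure X} [IsFiniteMeasure P] {s f : X → ℝ}

/-- The tangent at `planck 1`, of slope one, dominates the density by a constant plus `f`. -/
theorem integrable_entropyDensity (hf : Integrable f P) (hf0 : ∀ᵐ p ∂P, 0 ≤ f p) :
    Integrable (fun p => entropyDensity (f p)) P := by
  refine ((integrable_const (entropyDensity (planck 1) - planck 1)).add hf).mono'
    (measurable_entropyDensity.comp_aemeasurable hf.aemeasurable).aestronglyMeasurable ?_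
  filter_upwards [hf0] with p hp
  rw [Real.norm_eq_abs, abs_of_nonneg (entropyDensity_nonneg hp)]
  have := entropyDensity_le one_pos hp
  simp only [Pi.add_apply]
  linarith

/-- Gibbs' variational principle. -/
theorem integral_entropyDensity_le (hspos : ∀ᵐ p ∂P, 0 < s p)
    (hf : Integrable f P) (hf0 : ∀ᵐ p ∂P, 0 ≤ f p)
    (hb : Integrable (fun p => planck (s p)) P)
    (hsf : Integrable (fun p => s p * f p) P)
    (hsb : Integrable (fun p => s p * planck (s p)) P)
    (h : ∫ p, s p * f p ∂P ≤ ∫ p, s p * planck (s p) ∂P) :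
    ∫ p, entropyDensity (f p) ∂P ≤ ∫ p, entropyDensity (planck (s p)) ∂P ∧
    (∫ p, entropyDensity (planck (s p)) ∂P ≤ ∫ p, entropyDensity (f p) ∂P →
      ∀ᵐ p ∂P, f p = planck (s p)) := by
  have hb0 : ∀ᵐ p ∂P, 0 ≤ planck (s p) := hspos.mono fun p hp => planck_nonneg hp.le
  have i1 := integrable_entropyDensity hb hb0
  have i2 := integrable_entropyDensity hf hf0
  -- This is the pointwise deficit in the tangent inequality: it is nonnegative and vanishes only at
  -- contact, so a zero integral forces `f = planck s` a.e.
  set gap : X → ℝ := fun p => (entropyDensity (planck (s p)) - entropyDensity (f p)) +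
    (s p * f p - s p * planck (s p)) with hgap
  have igap : Integrable gap P := (i1.sub i2).add (hsf.sub hsb)
  have hgap_int : ∫ p, gap p ∂P = (∫ p, entropyDensity (planck (s p)) ∂P -
      ∫ p, entropyDensity (f p) ∂P) + (∫ p, s p * f p ∂P - ∫ p, s p * planck (s p) ∂P) := by
    rw [← integral_sub i1 i2, ← integral_sub hsf hsb]
    exact integral_add (i1.sub i2) (hsf.sub hsb)
  have hgap0 : 0 ≤ᵐ[P] gap := by
    filter_upwards [hspos, hf0] with p hp hfp
    have := entropyDensity_le hp hfp
    simp only [hgap, Pi.zero_apply]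
    linarith
  have hge := integral_nonneg_of_ae hgap0
  refine ⟨by linarith, fun hle => ?_⟩
  have hz := (integral_eq_zero_iff_of_nonneg_ae hgap0 igap).1 (by linarith)
  filter_upwards [hz, hspos, hf0] with p hp hsp hfp
  by_contra hne
  have := entropyDensity_lt hsp hfp hne
  simp only [hgap, Pi.zero_apply] at hp
  linarith

end Gibbs

/-! ### Maximizers on the torus -/

variable {d : ℕ} {ω : Torus d → ℝ} {M₀ E₀ μ ν : ℝ}

theorem bose_eq (ω : Torus d → ℝ) (μ ν : ℝ) :
    bose ω μ ν = volume.withDensity fun p => boseDensity (μ * ω p + ν) := rfl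

theorem measurable_boseDensity_comp (hω : Continuous ω) (μ ν : ℝ) :
    Measurable fun p => boseDensity (μ * ω p + ν) :=
  (continuous_boseDensity.comp (by fun_prop)).measurable

theorem mass_bose (ω : Torus d → ℝ) (μ ν : ℝ) :
    mass (bose ω μ ν) = ∫⁻ p, boseDensity (μ * ω p + ν) := by
  rw [mass, bose_eq, withDensity_apply _ MeasurableSet.univ, Measure.restrict_univ]

theorem energy_bose (hω : Continuous ω) (μ ν : ℝ) :
    energy ω (bose ω μ ν) = ∫⁻ p, boseDensity (μ * ω p + ν) * ENNReal.ofReal (ω p) := by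
  rw [energy, bose_eq, lintegral_withDensity_eq_lintegral_mul _
    (measurable_boseDensity_comp hω μ ν) hω.measurable.ennreal_ofReal]
  rfl

theorem isFiniteMeasure_of_mem_constraintSet {ρ : Measure (Torus d)}
    (hρ : ρ ∈ constraintSet ω M₀ E₀) : IsFiniteMeasure ρ :=
  ⟨by rw [show ρ univ = ENNReal.ofReal M₀ from hρ.1]; exact ENNReal.ofReal_lt_top⟩

theorem integrable_of_continuous {ρ : Measure (Torus d)} [IsFiniteMeasure ρ] {g : Torus d → ℝ}
    (hg : Continuous g) : Integrable g ρ :=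
  hg.integrable_of_hasCompactSupport (HasCompactSupport.of_compactSpace g)

theorem integral_of_mem_constraintSet (hω : Continuous ω) (hω0 : ∀ p, 0 ≤ ω p) (hM : 0 ≤ M₀)
    (hE : 0 ≤ E₀) (μ ν : ℝ) {ρ : Measure (Torus d)} (hρ : ρ ∈ constraintSet ω M₀ E₀) :
    ∫ p, (μ * ω p + ν) ∂ρ = μ * E₀ + ν * M₀ := by
  have := isFiniteMeasure_of_mem_constraintSet hρ
  have h1 : ∫ p, ω p ∂ρ = E₀ := by
    rw [integral_eq_lintegral_of_nonneg_ae (Eventually.of_forall hω0) hω.aestronglyMeasurable,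
      show ∫⁻ p, ENNReal.ofReal (ω p) ∂ρ = ENNReal.ofReal E₀ from hρ.2, ENNReal.toReal_ofReal hE]
  have h2 : ρ.real univ = M₀ := by
    rw [measureReal_def, show ρ univ = ENNReal.ofReal M₀ from hρ.1, ENNReal.toReal_ofReal hM]
  rw [integral_add ((integrable_of_continuous hω).const_mul μ) (integrable_const ν),
    integral_const_mul, integral_const, h1, h2, smul_eq_mul, mul_comm M₀]

/-- Integration of a continuous function against the Lebesgue decomposition. -/
theorem integral_eq_add_singularPart {ρ : Measure (Torus d)} [IsFiniteMeasure ρ]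
    {g : Torus d → ℝ} (hg : Continuous g) :
    ∫ p, g p ∂ρ = (∫ p, g p * (ρ.rnDeriv volume p).toReal) + ∫ p, g p ∂(ρ.singularPart volume) := by
  conv_lhs => rw [ρ.haveLebesgueDecomposition_add volume]
  rw [integral_add_measure (integrable_of_continuous hg) (integrable_of_continuous hg), add_comm,
    integral_withDensity_eq_integral_toReal_smul (ρ.measurable_rnDeriv volume)
      (ρ.rnDeriv_lt_top volume)]
  simp only [smul_eq_mul, mul_comm]

theorem rnDeriv_bose_add (hω : Continuous ω) [IsFiniteMeasure (bose ω μ ν)]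
    {σ : Measure (Torus d)} [IsFiniteMeasure σ] (hσ : σ ⟂ₘ volume) :
    (bose ω μ ν + σ).rnDeriv volume =ᵐ[volume] fun p => boseDensity (μ * ω p + ν) := by
  filter_upwards [Measure.rnDeriv_add (bose ω μ ν) σ volume, hσ.rnDeriv_ae_eq_zero,
    Measure.rnDeriv_withDensity volume (measurable_boseDensity_comp hω μ ν)] with p h1 h2 h3
  rw [h1, Pi.add_apply, h2, bose_eq, h3, Pi.zero_apply, add_zero]

/-- The maximizers are the Bose-Einstein equilibrium plus a condensate on `{ω = c}`. -/
theorem isMaximizer_iff_exists_condensate (hω : Continuous ω) (hω0 : ∀ p, 0 ≤ ω p) (hM : 0 ≤ M₀)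
    (hE : 0 ≤ E₀) {m c : ℝ} (hparam : IsBoseParam ω μ ν)
    (hpos : ∀ᵐ p, 0 < μ * ω p + ν) (hcrit : m = 0 ∨ ∀ p, μ * ω p + ν = 0 ↔ ω p = c)
    (hc : ∃ p, ω p = c) (hc0 : volume {p | ω p = c} = 0)
    (hmass : mass (bose ω μ ν) + ENNReal.ofReal m = ENNReal.ofReal M₀)
    (henergy : energy ω (bose ω μ ν) + ENNReal.ofReal (c * m) = ENNReal.ofReal E₀)
    (ρ : Measure (Torus d)) :
    IsMaximizer ω M₀ E₀ ρ ↔ ∃ σ : Measure (Torus d), σ ⟂ₘ volume ∧ σ {p | ω p ≠ c} = 0 ∧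
      mass σ = ENNReal.ofReal m ∧ ρ = bose ω μ ν + σ := by
  obtain ⟨p₀, hp₀⟩ := hc
  have hc_nonneg : 0 ≤ c := hp₀ ▸ hω0 p₀
  set s : Torus d → ℝ := fun p => μ * ω p + ν with hs
  have hsc : Continuous s := by fun_prop
  have hmassB : mass (bose ω μ ν) ≠ ∞ :=
    ((le_self_add.trans hmass.le).trans_lt ENNReal.ofReal_lt_top).ne
  have hBfin : IsFiniteMeasure (bose ω μ ν) := ⟨hmassB.lt_top⟩
  have hfinσ : ∀ {σ : Measure (Torus d)}, mass σ = ENNReal.ofReal m → IsFiniteMeasure σ :=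
    fun {σ} h => ⟨by rw [show σ univ = _ from h]; exact ENNReal.ofReal_lt_top⟩
  have hBlt : ∀ᵐ p, boseDensity (s p) < ∞ := hpos.mono fun p hp => by
    rw [boseDensity_of_pos hp]; exact ENNReal.ofReal_lt_top
  have hbi : Integrable fun p => planck (s p) := by
    refine (integrable_toReal_of_lintegral_ne_top
      (measurable_boseDensity_comp hω μ ν).aemeasurable (mass_bose ω μ ν ▸ hmassB)).congr ?_
    exact Eventually.of_forall fun p => toReal_boseDensity (hparam p)
  have hsmul : ∀ {f : Torus d → ℝ}, Integrable f → Integrable fun p => s p * f p := by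
    intro f hf
    obtain ⟨C, hC⟩ := isCompact_univ.exists_bound_of_continuousOn hsc.continuousOn
    exact hf.bdd_mul hsc.aestronglyMeasurable (Eventually.of_forall fun p => hC p (mem_univ p))
  have hmem : ∀ σ : Measure (Torus d), σ {p | ω p ≠ c} = 0 → mass σ = ENNReal.ofReal m →
      bose ω μ ν + σ ∈ constraintSet ω M₀ E₀ := by
    intro σ h1 h2
    refine ⟨by rw [← hmass, ← h2]; rfl, ?_⟩
    have : energy ω σ = ENNReal.ofReal (c * m) := by
      rw [energy, lintegral_congr_ae (g := fun _ => ENNReal.ofReal c)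
        ((show ∀ᵐ p ∂σ, ω p = c from h1).mono fun p hp => by simp only [hp]), lintegral_const,
        ENNReal.ofReal_mul hc_nonneg, ← h2]
      rfl
    rw [← henergy, ← this, energy, lintegral_add_measure]
    rfl
  have hent : ∀ σ : Measure (Torus d), σ ⟂ₘ volume → mass σ = ENNReal.ofReal m →
      entropy (bose ω μ ν + σ) = ∫ p, entropyDensity (planck (s p)) := by
    intro σ h1 h2
    have := hfinσ h2
    refine integral_congr_ae ?_
    filter_upwards [rnDeriv_bose_add (μ := μ) (ν := ν) hω h1] with p hp
    rw [hp, toReal_boseDensity (hparam p)]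
  -- A point condensate at `p₀` gives one admissible competitor that attains the Gibbs bound.
  set σ₀ : Measure (Torus d) := ENNReal.ofReal m • Measure.dirac p₀ with hσ₀
  have hσ₀m : mass σ₀ = ENNReal.ofReal m := by simp [mass, hσ₀]
  have hσ₀fin := hfinσ hσ₀m
  have hmeas : MeasurableSet {p | ω p = c} := measurableSet_eq_fun hω.measurable measurable_const
  have hcompl : {p | ω p ≠ c} = {p | ω p = c}ᶜ := rfl
  have hσ₀c : σ₀ {p | ω p ≠ c} = 0 := by
    rw [hσ₀, Measure.smul_apply, hcompl, Measure.dirac_apply' _ hmeas.compl]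
    simp [hp₀]
  have hσ₀s : σ₀ ⟂ₘ volume := ⟨{p | ω p = c}ᶜ, hmeas.compl, hσ₀c, by rwa [compl_compl]⟩
  have hbal : ∫ p, s p ∂(bose ω μ ν) + ∫ p, s p ∂σ₀ = μ * E₀ + ν * M₀ := by
    rw [← integral_add_measure (integrable_of_continuous hsc) (integrable_of_continuous hsc)]
    exact integral_of_mem_constraintSet hω hω0 hM hE μ ν (hmem σ₀ hσ₀c hσ₀m)
  have hsσ₀ : ∫ p, s p ∂σ₀ = 0 := by
    rw [hσ₀, integral_smul_measure, integral_dirac]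
    rcases hcrit with rfl | h
    · simp
    · simp [show s p₀ = 0 from (h p₀).2 hp₀]
  have hsB : ∫ p, s p ∂(bose ω μ ν) = ∫ p, s p * planck (s p) := by
    rw [bose_eq, integral_withDensity_eq_integral_toReal_smul
      (measurable_boseDensity_comp hω μ ν) hBlt]
    refine integral_congr_ae (Eventually.of_forall fun p => ?_)
    simp only [smul_eq_mul]
    rw [toReal_boseDensity (hparam p), mul_comm]
  have hsplit : ∀ ρ ∈ constraintSet ω M₀ E₀, (∫ p, s p * (ρ.rnDeriv volume p).toReal) +
      ∫ p, s p ∂(ρ.singularPart volume) = ∫ p, s p * planck (s p) := by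
    intro ρ hρ
    have := isFiniteMeasure_of_mem_constraintSet hρ
    rw [← integral_eq_add_singularPart hsc, ← hsB,
      show ∫ p, s p ∂ρ = _ from integral_of_mem_constraintSet hω hω0 hM hE μ ν hρ, ← hbal, hsσ₀,
      add_zero]
  have hgibbs : ∀ ρ ∈ constraintSet ω M₀ E₀,
      entropy ρ ≤ ∫ p, entropyDensity (planck (s p)) ∧
      (∫ p, entropyDensity (planck (s p)) ≤ entropy ρ →
        ∀ᵐ p, (ρ.rnDeriv volume p).toReal = planck (s p)) := by
    intro ρ hρ
    have := isFiniteMeasure_of_mem_constraintSet hρ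
    have hfi : Integrable fun p => (ρ.rnDeriv volume p).toReal := Measure.integrable_toReal_rnDeriv
    refine integral_entropyDensity_le hpos hfi (Eventually.of_forall fun p =>
      ENNReal.toReal_nonneg) hbi (hsmul hfi) (hsmul hbi) ?_
    have hnn : 0 ≤ ∫ p, s p ∂(ρ.singularPart volume) := integral_nonneg hparam
    exact (le_add_of_nonneg_right hnn).trans (hsplit ρ hρ).le
  constructor
  · rintro ⟨hρ, hmax⟩
    have := isFiniteMeasure_of_mem_constraintSet hρ
    have hae := (hgibbs ρ hρ).2 (by
      rw [← hent σ₀ hσ₀s hσ₀m]; exact hmax (hmem σ₀ hσ₀c hσ₀m))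
    have hdec : ρ = bose ω μ ν + ρ.singularPart volume := by
      conv_lhs => rw [ρ.haveLebesgueDecomposition_add volume, add_comm]
      congr 1
      refine withDensity_congr_ae ?_
      filter_upwards [hae, hBlt, ρ.rnDeriv_lt_top volume] with p h1 h2 h3
      rw [← toReal_boseDensity (hparam p)] at h1
      exact (ENNReal.toReal_eq_toReal_iff' h3.ne h2.ne).1 h1
    have hmσ : mass (ρ.singularPart volume) = ENNReal.ofReal m := by
      have h1 : mass (bose ω μ ν) + mass (ρ.singularPart volume) =
          mass (bose ω μ ν) + ENNReal.ofReal m := by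
        rw [hmass, ← hρ.1]
        conv_rhs => rw [hdec]
        rfl
      exact (ENNReal.add_right_inj hmassB).1 h1
    refine ⟨ρ.singularPart volume, ρ.mutuallySingular_singularPart volume, ?_, hmσ, hdec⟩
    rcases hcrit with rfl | h
    · rw [ENNReal.ofReal_zero, mass, Measure.measure_univ_eq_zero] at hmσ
      simp [hmσ]
    -- With the density already equal to `planck s`, the budget `hsplit` leaves nothing for the
    -- singular part.
    · have hz : ∫ p, s p ∂(ρ.singularPart volume) = 0 := by
        have h1 := hsplit ρ hρ
        have h2 : ∫ p, s p * (ρ.rnDeriv volume p).toReal = ∫ p, s p * planck (s p) :=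
          integral_congr_ae (hae.mono fun p hp => by simp only [hp])
        linarith
      have h0 := (integral_eq_zero_iff_of_nonneg (μ := ρ.singularPart volume) hparam
        (integrable_of_continuous hsc)).1 hz
      exact h0.mono fun p hp => (h p).1 hp
  · rintro ⟨σ, h1, h2, h3, rfl⟩
    refine ⟨hmem σ h2 h3, fun ρ hρ => ?_⟩
    change entropy ρ ≤ entropy (bose ω μ ν + σ)
    rw [hent σ h1 h3]
    exact (hgibbs ρ hρ).1

/-! ### Moments of critical densities -/

section Density

variable {X : Type*} [MeasurableSpace X] {P : Measure X} {s g : X → ℝ}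

theorem lintegral_boseDensity_mul (hspos : ∀ᵐ p ∂P, 0 < s p)
    (hg0 : ∀ p, 0 ≤ g p) (hi : Integrable (fun p => g p * planck (s p)) P) :
    ∫⁻ p, boseDensity (s p) * ENNReal.ofReal (g p) ∂P =
      ENNReal.ofReal (∫ p, g p * planck (s p) ∂P) := by
  rw [ofReal_integral_eq_lintegral_ofReal hi
    (hspos.mono fun p hp => mul_nonneg (hg0 p) (planck_nonneg hp.le))]
  refine lintegral_congr_ae ?_
  filter_upwards [hspos] with p hp
  rw [boseDensity_of_pos hp, mul_comm, ENNReal.ofReal_mul (hg0 p)]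

theorem lintegral_boseDensity (hspos : ∀ᵐ p ∂P, 0 < s p)
    (hi : Integrable (fun p => planck (s p)) P) :
    ∫⁻ p, boseDensity (s p) ∂P = ENNReal.ofReal (∫ p, planck (s p) ∂P) := by
  simpa using lintegral_boseDensity_mul (g := fun _ => 1) hspos (by simp) (by simpa using hi)

theorem const_mul_lintegral_mul_eq {b u v w : X → ℝ≥0∞} {c r : ℝ≥0∞} (hb : Measurable b)
    (hu : Measurable u) (hw : Measurable w) (h : ∀ p, c * w p = r * u p + v p) :
    c * ∫⁻ p, b p * w p ∂P = r * ∫⁻ p, b p * u p ∂P + ∫⁻ p, b p * v p ∂P := by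
  have hbu : Measurable fun p => b p * u p := hb.mul hu
  have hbw : Measurable fun p => b p * w p := hb.mul hw
  rw [← lintegral_const_mul _ hbw, ← lintegral_const_mul _ hbu,
    ← lintegral_add_left (hbu.const_mul r)]
  refine lintegral_congr fun p => ?_
  rw [mul_left_comm, h p]
  ring

theorem const_mul_lintegral_eq {b u v : X → ℝ≥0∞} {c : ℝ≥0∞} (hb : Measurable b)
    (hu : Measurable u) (h : ∀ p, c = u p + v p) :
    c * ∫⁻ p, b p ∂P = ∫⁻ p, b p * u p ∂P + ∫⁻ p, b p * v p ∂P := by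
  simpa using const_mul_lintegral_mul_eq (P := P) (w := fun _ => 1) (r := 1) hb hu
    measurable_const (by simpa using h)

/-- On `[0, 1]` the convex function `exp (t * x) - 1` lies below its chord. Hence a critical
equilibrium of finite mass forces `∫ 1/g < ∞`. -/
theorem inv_ofReal_le_boseDensity {t x : ℝ} (ht : 0 < t) (hx0 : 0 < x) (hx : x ≤ 1) :
    (ENNReal.ofReal x)⁻¹ ≤ ENNReal.ofReal (Real.exp t - 1) * boseDensity (t * x) := by
  have htx := exp_sub_one_pos (mul_pos ht hx0)
  rw [boseDensity_of_pos (mul_pos ht hx0), ← ENNReal.ofReal_mul (exp_sub_one_pos ht).le,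
    ← ENNReal.ofReal_inv_of_pos hx0]
  refine ENNReal.ofReal_le_ofReal ?_
  have h := convexOn_exp.2 (mem_univ t) (mem_univ 0) hx0.le (sub_nonneg.2 hx) (by ring)
  simp only [smul_eq_mul, mul_zero, add_zero, Real.exp_zero, mul_one] at h
  rw [planck, ← div_eq_mul_inv, le_div_iff₀ htx, inv_mul_le_iff₀ hx0]
  rw [mul_comm t x]
  linarith

/-- A critical equilibrium leaves no room for a nonnegative condensate when the excess energy lies
above the boundary curve. -/
theorem IsBoundaryFunction.le_of_lintegral_boseDensity [IsFiniteMeasure P] {F : ℝ → ℝ}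
    {k : X → ℝ} {c t U V M₀ : ℝ}
    (hF : IsBoundaryFunction P g F) (hg : Measurable g)
    (h0 : ∀ᵐ p ∂P, 0 < g p) (hgI : ∀ p, g p ∈ Icc (0 : ℝ) 1) (hk0 : ∀ p, 0 ≤ k p)
    (hc : 0 < c) (hgk : ∀ p, g p + k p = c) (ht : 0 < t) (hU : 0 ≤ U) (hV : 0 ≤ V)
    (hM : 0 ≤ M₀) (hUV : U + V = c * M₀)
    (h1 : ∫⁻ p, boseDensity (t * g p) * ENNReal.ofReal (g p) ∂P = ENNReal.ofReal U)
    (h2 : ∫⁻ p, boseDensity (t * g p) * ENNReal.ofReal (k p) ∂P ≤ ENNReal.ofReal V) :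
    U ≤ F M₀ := by
  have hs : Measurable fun p => t * g p := hg.const_mul t
  have hspos : ∀ᵐ p ∂P, 0 < t * g p := h0.mono fun p hp => mul_pos ht hp
  have hB : Measurable fun p => boseDensity (t * g p) :=
    continuous_boseDensity.measurable.comp hs
  -- Adding the two moment relations, with `g + k = c`, bounds the mass by `M₀`; monotonicity of `F`
  -- then finishes.
  have hle : ∫⁻ p, boseDensity (t * g p) ∂P ≤ ENNReal.ofReal M₀ := by
    have h3 : ENNReal.ofReal c * ∫⁻ p, boseDensity (t * g p) ∂P ≤
        ENNReal.ofReal c * ENNReal.ofReal M₀ := by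
      rw [← ENNReal.ofReal_mul hc.le, ← hUV, ENNReal.ofReal_add hU hV, ← h1,
        const_mul_lintegral_eq hB hg.ennreal_ofReal fun p => by
          rw [← hgk p, ENNReal.ofReal_add (hgI p).1 (hk0 p)]]
      exact add_le_add le_rfl h2
    exact (ENNReal.mul_le_mul_iff_right (by simpa using hc) ENNReal.ofReal_ne_top).1 h3
  have hfin : ∫⁻ p, (ENNReal.ofReal (g p))⁻¹ ∂P < ∞ := by
    refine (lintegral_mono_ae (h0.mono fun p hp =>
      inv_ofReal_le_boseDensity ht hp (hgI p).2)).trans_lt ?_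
    rw [lintegral_const_mul _ hB]
    exact ENNReal.mul_lt_top ENNReal.ofReal_lt_top (hle.trans_lt ENNReal.ofReal_lt_top)
  have hI := integrable_inv_of_lintegral hg h0 hfin
  have hg1 : ∀ p, |g p| ≤ 1 := fun p => abs_le.2 ⟨by linarith [(hgI p).1], (hgI p).2⟩
  rw [lintegral_boseDensity hspos (integrable_planck hg h0 hI ht),
    ENNReal.ofReal_le_ofReal_iff hM] at hle
  rw [lintegral_boseDensity_mul hspos (fun p => (hgI p).1)
    (integrable_mul_planck hg h0 hI hg hg1 ht), ENNReal.ofReal_eq_ofReal_iff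
    (integral_nonneg_of_ae (h0.mono fun p hp =>
      mul_nonneg hp.le (planck_nonneg (mul_pos ht hp).le))) hU] at h1
  obtain ⟨hN, hFN⟩ := hF.curve hfin t ht
  rw [← h1, ← hFN]
  exact hF.monotoneOn hN.le hM hle

end Density

/-! ### Solving for the mass and energy constraints -/

section Torus

variable {d : ℕ} {ω g : Torus d → ℝ} {F : ℝ → ℝ} {c e : ℝ}

theorem measureReal_univ_torus (d : ℕ) :
    (volume : Measure (Torus d)).real univ = (2 * Real.pi) ^ d := by
  rw [measureReal_def, volume_pi, Measure.pi_univ]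
  simp [AddCircle.measure_univ, Real.pi_pos.le]

theorem volume_lt_ne_zero (hg : Continuous g) {p₀ : Torus d} (hp₀ : g p₀ = 0) :
    ∀ ε > 0, volume {p | g p < ε} ≠ 0 := fun ε hε =>
  (isOpen_lt hg continuous_const).measure_ne_zero volume ⟨p₀, by
    rwa [mem_ofPred_eq, hp₀]⟩

/-- Mass and energy of the critical equilibrium `1 / (e^{t g} - 1)`, where `ω = c + e g`. -/
theorem IsBoundaryFunction.mass_energy (hF : IsBoundaryFunction volume g F) (hω : Continuous ω)
    (hω0 : ∀ p, 0 ≤ ω p) (hω1 : ∀ p, ω p ≤ 1) (hg : Measurable g) (h0 : ∀ᵐ p, 0 < g p)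
    (hgI : ∀ p, g p ∈ Icc (0 : ℝ) 1) (hge : ∀ p, ω p = c + e * g p)
    (hfin : ∫⁻ p, (ENNReal.ofReal (g p))⁻¹ < ∞) {t : ℝ} (ht : 0 < t) :
    0 ≤ c * (∫ p, planck (t * g p)) + e * F (∫ p, planck (t * g p)) ∧
    ∀ μ ν : ℝ, (∀ p, μ * ω p + ν = t * g p) →
      mass (bose ω μ ν) = ENNReal.ofReal (∫ p, planck (t * g p)) ∧
      energy ω (bose ω μ ν) = ENNReal.ofReal
        (c * (∫ p, planck (t * g p)) + e * F (∫ p, planck (t * g p))) := by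
  have hs : Measurable fun p => t * g p := hg.const_mul t
  have hspos : ∀ᵐ p, 0 < t * g p := h0.mono fun p hp => mul_pos ht hp
  have hI := integrable_inv_of_lintegral hg h0 hfin
  have hg1 : ∀ p, |g p| ≤ 1 := fun p => abs_le.2 ⟨by linarith [(hgI p).1], (hgI p).2⟩
  have hωabs : ∀ p, |ω p| ≤ 1 := fun p => abs_le.2 ⟨by linarith [hω0 p], hω1 p⟩
  have i1 := integrable_planck hg h0 hI ht
  have i2 := integrable_mul_planck hg h0 hI hg hg1 ht
  have i3 := integrable_mul_planck hg h0 hI hω.measurable hωabs ht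
  have hen : ∫ p, ω p * planck (t * g p) =
      c * (∫ p, planck (t * g p)) + e * F (∫ p, planck (t * g p)) := by
    rw [(hF.curve hfin t ht).2, ← integral_const_mul, ← integral_const_mul,
      ← integral_add (i1.const_mul c) (i2.const_mul e)]
    refine integral_congr_ae (Eventually.of_forall fun p => ?_)
    simp only [hge p]
    ring
  rw [← hen]
  refine ⟨integral_nonneg_of_ae (hspos.mono fun p hp => mul_nonneg (hω0 p)
    (planck_nonneg hp.le)), fun μ ν hμν => ?_⟩
  rw [mass_bose, energy_bose hω]
  simp only [hμν]
  exact ⟨lintegral_boseDensity hspos i1, lintegral_boseDensity_mul hspos hω0 i3⟩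

/-- The critical curve is the graph of `M ↦ c M + e F(M)`. -/
theorem IsBoundaryFunction.image_eq_graph (hF : IsBoundaryFunction volume g F)
    (hω : Continuous ω) (hω0 : ∀ p, 0 ≤ ω p) (hω1 : ∀ p, ω p ≤ 1) (hg : Measurable g)
    (h0 : ∀ᵐ p, 0 < g p) (hgI : ∀ p, g p ∈ Icc (0 : ℝ) 1) (hge : ∀ p, ω p = c + e * g p)
    (hfin : ∫⁻ p, (ENNReal.ofReal (g p))⁻¹ < ∞) {μ ν : ℝ → ℝ}
    (hμν : ∀ t p, μ t * ω p + ν t = t * g p) :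
    (fun t : ℝ => ((mass (bose ω (μ t) (ν t))).toReal,
      (energy ω (bose ω (μ t) (ν t))).toReal)) '' Ioi 0 =
    {x : ℝ × ℝ | 0 < x.1 ∧ x.2 = c * x.1 + e * F x.1} := by
  have key : ∀ t > 0, ((mass (bose ω (μ t) (ν t))).toReal,
      (energy ω (bose ω (μ t) (ν t))).toReal) = (∫ p, planck (t * g p),
        c * (∫ p, planck (t * g p)) + e * F (∫ p, planck (t * g p))) := by
    intro t ht
    obtain ⟨h1, h2⟩ := hF.mass_energy hω hω0 hω1 hg h0 hgI hge hfin ht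
    obtain ⟨h3, h4⟩ := h2 (μ t) (ν t) (hμν t)
    rw [h3, h4, ENNReal.toReal_ofReal h1, ENNReal.toReal_ofReal (hF.curve hfin t ht).1.le]
  ext ⟨x, y⟩
  constructor
  · rintro ⟨t, ht, h⟩
    simp only [key t ht, Prod.mk.injEq] at h
    obtain ⟨rfl, rfl⟩ := h
    exact ⟨(hF.curve hfin t ht).1, rfl⟩
  · rintro ⟨hx, hy⟩
    obtain ⟨t, ht, h⟩ := hF.surj hfin x hx
    refine ⟨t, ht, ?_⟩
    simp only [key t ht, h, Prod.mk.injEq, true_and]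
    exact hy.symm

/-- On or beyond the boundary curve the maximizers are a critical equilibrium plus a condensate
on `{g = 0}`. -/
theorem IsBoundaryFunction.exists_condensate (hF : IsBoundaryFunction volume g F)
    (hω : Continuous ω) (hω0 : ∀ p, 0 ≤ ω p) (hω1 : ∀ p, ω p ≤ 1) (hg : Measurable g)
    (h0 : ∀ᵐ p, 0 < g p) (hgI : ∀ p, g p ∈ Icc (0 : ℝ) 1) (hge : ∀ p, ω p = c + e * g p)
    (he : e * e = 1) (hc : 0 ≤ c) (hcω : ∃ p, ω p = c) (hc0 : volume {p | ω p = c} = 0)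
    {M₀ E₀ : ℝ} (hM : 0 < M₀) (hE : 0 < E₀) (hpos : 0 < e * (E₀ - c * M₀))
    (hle : e * (E₀ - c * M₀) ≤ F M₀) :
    ∃ t m : ℝ, 0 < t ∧ 0 ≤ m ∧ ∀ μ ν : ℝ, (∀ p, μ * ω p + ν = t * g p) →
      mass (bose ω μ ν) + ENNReal.ofReal m = ENNReal.ofReal M₀ ∧
      energy ω (bose ω μ ν) + ENNReal.ofReal (c * m) = ENNReal.ofReal E₀ ∧
      ∀ ρ : Measure (Torus d), IsMaximizer ω M₀ E₀ ρ ↔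
        ∃ σ : Measure (Torus d), σ ⟂ₘ volume ∧ σ {p | ω p ≠ c} = 0 ∧
          mass σ = ENNReal.ofReal m ∧ ρ = bose ω μ ν + σ := by
  have hfin : ∫⁻ p, (ENNReal.ofReal (g p))⁻¹ < ∞ := by
    rw [lt_top_iff_ne_top]
    intro h
    rw [hF.eq_zero h, Pi.zero_apply] at hle
    linarith
  -- `N` is the mass of the equilibrium that carries the entire excess energy; a condensate on `{g =
  -- 0}` contributes none.
  obtain ⟨N, ⟨hN0, hNM⟩, hFN⟩ := intermediate_value_Icc hM.le
    (hF.differentiableOn.continuousOn.mono Icc_subset_Ici_self)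
    (show e * (E₀ - c * M₀) ∈ Icc (F 0) (F M₀) from ⟨hF.zero.trans_le hpos.le, hle⟩)
  have hN : 0 < N := hN0.lt_of_ne (by
    rintro rfl
    rw [hF.zero] at hFN
    linarith)
  obtain ⟨t, ht, htN⟩ := hF.surj hfin N hN
  obtain ⟨h1, h2⟩ := hF.mass_energy hω hω0 hω1 hg h0 hgI hge hfin ht
  rw [htN] at h1 h2
  refine ⟨t, M₀ - N, ht, sub_nonneg.2 hNM, fun μ ν hμν => ?_⟩
  obtain ⟨h3, h4⟩ := h2 μ ν hμν
  have hmass : mass (bose ω μ ν) + ENNReal.ofReal (M₀ - N) = ENNReal.ofReal M₀ := by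
    rw [h3, ← ENNReal.ofReal_add hN.le (sub_nonneg.2 hNM), add_sub_cancel]
  have henergy : energy ω (bose ω μ ν) + ENNReal.ofReal (c * (M₀ - N)) = ENNReal.ofReal E₀ := by
    rw [h4, ← ENNReal.ofReal_add h1 (mul_nonneg hc (sub_nonneg.2 hNM)), hFN]
    congr 1
    linear_combination (E₀ - c * M₀) * he
  refine ⟨hmass, henergy, isMaximizer_iff_exists_condensate hω hω0 hM.le hE.le (fun p => ?_) ?_
    (Or.inr fun p => ?_) hcω hc0 hmass henergy⟩
  · rw [hμν p]
    exact mul_nonneg ht.le (hgI p).1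
  · filter_upwards [h0] with p hp
    rw [hμν p]
    exact mul_pos ht hp
  · have he0 : e ≠ 0 := by
      rintro rfl
      simp at he
    rw [hμν p, hge p]
    simp [ht.ne', he0]

/-- The density is infinite wherever the exponent vanishes, so finite mass makes that set null. -/
theorem ae_pos_of_mass_ne_top (hω : Continuous ω) {μ ν : ℝ} (hparam : IsBoseParam ω μ ν)
    (h : mass (bose ω μ ν) ≠ ∞) : ∀ᵐ p, 0 < μ * ω p + ν := by
  rw [mass_bose] at h
  filter_upwards [ae_lt_top (measurable_boseDensity_comp hω μ ν) h] with p hp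
  refine (hparam p).lt_of_ne fun h0 => ?_
  rw [← h0, boseDensity_zero] at hp
  exact lt_irrefl _ hp

theorem isMaximizer_iff_eq_bose (hω : Continuous ω) (hω0 : ∀ p, 0 ≤ ω p) (hcω : ∃ p, ω p = c)
    (hc0 : volume {p | ω p = c} = 0) {M₀ E₀ : ℝ} (hM : 0 ≤ M₀) (hE : 0 ≤ E₀) {μ ν : ℝ}
    (hparam : IsBoseParam ω μ ν) (hmem : bose ω μ ν ∈ constraintSet ω M₀ E₀)
    (ρ : Measure (Torus d)) : IsMaximizer ω M₀ E₀ ρ ↔ ρ = bose ω μ ν := by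
  have hfin : mass (bose ω μ ν) ≠ ∞ := by rw [hmem.1]; exact ENNReal.ofReal_ne_top
  rw [isMaximizer_iff_exists_condensate (m := 0) hω hω0 hM hE hparam
    (ae_pos_of_mass_ne_top hω hparam hfin) (Or.inl rfl) hcω hc0 (by simpa using hmem.1)
    (by simpa using hmem.2)]
  constructor
  · rintro ⟨σ, -, -, h1, rfl⟩
    rw [ENNReal.ofReal_zero, mass, Measure.measure_univ_eq_zero] at h1
    rw [h1, add_zero]
  · rintro rfl
    exact ⟨0, Measure.MutuallySingular.zero_left, by simp, by simp [mass], by simp⟩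

/-- The density determines `μω + ν` almost everywhere, hence everywhere by continuity; two distinct
values of `ω` then determine both coefficients. -/
theorem bose_injective (hω : Continuous ω) {p q : Torus d} (hpq : ω p ≠ ω q) {μ ν μ' ν' : ℝ}
    (hparam : IsBoseParam ω μ ν) (hparam' : IsBoseParam ω μ' ν')
    (hfin : mass (bose ω μ ν) ≠ ∞) (h : bose ω μ ν = bose ω μ' ν') : μ = μ' ∧ ν = ν' := by
  have hpos := ae_pos_of_mass_ne_top hω hparam hfin
  have hpos' := ae_pos_of_mass_ne_top hω hparam' (h ▸ hfin)
  rw [mass_bose] at hfin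
  have hae := (withDensity_eq_iff (measurable_boseDensity_comp hω μ ν).aemeasurable
    (measurable_boseDensity_comp hω μ' ν').aemeasurable hfin).1 h
  have hs : (fun p => μ * ω p + ν) =ᵐ[volume] fun p => μ' * ω p + ν' := by
    filter_upwards [hae, hpos, hpos'] with r h1 h2 h3
    rw [boseDensity_of_pos h2, boseDensity_of_pos h3, ENNReal.ofReal_eq_ofReal_iff
      (planck_nonneg h2.le) (planck_nonneg h3.le)] at h1
    exact Real.exp_injective (sub_left_injective (inv_injective h1))
  have heq := (Continuous.ae_eq_iff_eq volume (by fun_prop) (by fun_prop)).1 hs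
  have hp := congrFun heq p
  have hq := congrFun heq q
  have hμ : μ = μ' := by
    have : (μ - μ') * (ω p - ω q) = 0 := by linear_combination hp - hq
    rcases mul_eq_zero.1 this with h | h
    · linarith
    · exact absurd (sub_eq_zero.1 h) hpq
  subst hμ
  exact ⟨rfl, by linarith⟩

/-- Strictly between the two boundary curves there is a Bose-Einstein equilibrium with the given
mass and energy. -/
theorem exists_bose_mem_constraintSet {a : ℝ} (hω : Continuous ω) (ha : 0 ≤ a) (ha1 : a < 1)
    (hωI : ∀ p, ω p ∈ Icc a 1) (hu : ∀ᵐ p, 0 < 1 - ω p) (hv : ∀ᵐ p, 0 < ω p - a) {F₁ F₂ : ℝ → ℝ}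
    (hF₁ : IsBoundaryFunction volume (fun p => 1 - ω p) F₁)
    (hF₂ : IsBoundaryFunction volume (fun p => ω p - a) F₂) {M₀ E₀ : ℝ} (hM : 0 < M₀)
    (hlow : a * M₀ < E₀) (hupp : E₀ < M₀) (h₁ : F₁ M₀ < M₀ - E₀)
    (h₂ : F₂ M₀ < E₀ - a * M₀) :
    ∃ μ ν : ℝ, IsBoseParam ω μ ν ∧ bose ω μ ν ∈ constraintSet ω M₀ E₀ := by
  have hc : 0 < 1 - a := sub_pos.2 ha1
  have hU : 0 < M₀ - E₀ := sub_pos.2 hupp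
  have hV : 0 < E₀ - a * M₀ := sub_pos.2 hlow
  have hum : Measurable fun p => 1 - ω p := measurable_const.sub hω.measurable
  have hvm : Measurable fun p => ω p - a := hω.measurable.sub_const a
  have hu0 : ∀ p, 0 ≤ 1 - ω p := fun p => sub_nonneg.2 (hωI p).2
  have hv0 : ∀ p, 0 ≤ ω p - a := fun p => sub_nonneg.2 (hωI p).1
  have huI : ∀ p, 1 - ω p ∈ Icc (0 : ℝ) 1 := fun p => ⟨hu0 p, by linarith [(hωI p).1]⟩
  have hvI : ∀ p, ω p - a ∈ Icc (0 : ℝ) 1 := fun p => ⟨hv0 p, by linarith [(hωI p).2]⟩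
  have hne : (volume : Measure (Torus d)) ≠ 0 := NeZero.ne _
  obtain ⟨x, y, hx, hy, hxy, hfin, hmin⟩ := exists_dual_minimizer (P := volume) hne hum hvm hc
    (fun p => by ring) hU hV
  obtain ⟨hxle, hxeq⟩ := lintegral_boseDensity_mul_of_minimizer hum hvm hu hu0 hv0 hU.le hV.le
    hx hy hfin fun x' hx' => hmin x' y hx' hy
  obtain ⟨hyle, hyeq⟩ := lintegral_boseDensity_mul_of_minimizer (u := fun p => ω p - a)
    (v := fun p => 1 - ω p) (x := y) (y := x) hvm hum hv hv0 hu0 hV.le hU.le hy hx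
    (by simpa only [add_comm] using hfin) fun y' hy' => by
      simpa only [add_comm] using hmin x y' hx hy'
  simp only [add_comm (y * _)] at hyle hyeq
  -- If `y = 0`, the minimizer is critical for `1 - ω`, which would give `M₀ - E₀ ≤ F₁ M₀`. The case
  -- `x = 0` is symmetric, with `F₂`.
  have hypos : 0 < y := hy.lt_of_ne (by
    rintro rfl
    have hx' : 0 < x := by linarith
    simp only [zero_mul, add_zero] at hxeq hyle
    exact (hF₁.le_of_lintegral_boseDensity hum hu huI hv0 hc (fun p => by ring) hx' hU.le
      hV.le hM.le (by ring) (hxeq hx') hyle).not_gt h₁)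
  have hxpos : 0 < x := hx.lt_of_ne (by
    rintro rfl
    simp only [zero_mul, zero_add] at hyeq hxle
    exact (hF₂.le_of_lintegral_boseDensity hvm hv hvI hu0 hc (fun p => by ring) hypos hV.le
      hU.le hM.le (by ring) (hyeq hypos) hxle).not_gt h₂)
  have hxe := hxeq hxpos
  have hye := hyeq hypos
  have hs : ∀ p, (y - x) * ω p + (x - a * y) = x * (1 - ω p) + y * (ω p - a) := fun p => by ring
  have hB : Measurable fun p => boseDensity (x * (1 - ω p) + y * (ω p - a)) :=
    continuous_boseDensity.measurable.comp ((hum.const_mul x).add (hvm.const_mul y))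
  have hc' : ENNReal.ofReal (1 - a) ≠ 0 := by simpa using ha1
  refine ⟨y - x, x - a * y, fun p => ?_, ?_, ?_⟩
  · rw [hs]
    exact add_nonneg (mul_nonneg hx (hu0 p)) (mul_nonneg hy (hv0 p))
  · rw [mass_bose]
    simp only [hs]
    -- Scaled by `1 - a`, mass is the sum of the `1 - ω` and `ω - a` moments; energy below is the
    -- same sum with weight `a` on the first.
    rw [← ENNReal.mul_right_inj hc' ENNReal.ofReal_ne_top, ← ENNReal.ofReal_mul hc.le,
      show (1 - a) * M₀ = (M₀ - E₀) + (E₀ - a * M₀) by ring, ENNReal.ofReal_add hU.le hV.le,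
      ← hxe, ← hye, const_mul_lintegral_eq hB hum.ennreal_ofReal fun p => by
        rw [← ENNReal.ofReal_add (hu0 p) (hv0 p)]; congr 1; ring]
  · rw [energy_bose hω]
    simp only [hs]
    rw [← ENNReal.mul_right_inj hc' ENNReal.ofReal_ne_top, ← ENNReal.ofReal_mul hc.le,
      show (1 - a) * E₀ = a * (M₀ - E₀) + (E₀ - a * M₀) by ring,
      ENNReal.ofReal_add (mul_nonneg ha hU.le) hV.le, ENNReal.ofReal_mul ha,
      ← hxe, ← hye]
    refine const_mul_lintegral_mul_eq hB hum.ennreal_ofReal hω.measurable.ennreal_ofReal fun p => ?_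
    rw [← ENNReal.ofReal_mul hc.le, ← ENNReal.ofReal_mul ha,
      ← ENNReal.ofReal_add (mul_nonneg ha (hu0 p)) (hv0 p)]
    congr 1
    ring

end Torus

end EntropyMax

/-! ### Assembly of the theorem -/

theorem theorem1p2 (d : ℕ) (ω : Torus d → ℝ) (a : ℝ)
    (hω : Continuous ω) (ha : 0 ≤ a)
    (hmin : IsLeast (range ω) a) (hmax : IsGreatest (range ω) 1)
    (hmin0 : volume {p | ω p = a} = 0) (hmax0 : volume {p | ω p = 1} = 0) :
    ∃ fp fm : ℝ → ℝ,
      -- the boundary curves of the region `S` and their properties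
      IsUpperCurve ω fp ∧ IsLowerCurve ω a fm ∧
      DifferentiableOn ℝ fp (Ici 0) ∧ DifferentiableOn ℝ fm (Ici 0) ∧
      StrictMonoOn fp (Ici 0) ∧ MonotoneOn fm (Ici 0) ∧
      (0 < a ∨ lowerIntegral ω a < ∞ → StrictMonoOn fm (Ici 0)) ∧
      Tendsto (fun M => fp M / M) atTop (𝓝 (beta ω)) ∧
      Tendsto (fun M => fm M / M) atTop (𝓝 (alpha ω a)) ∧
      (∀ M, 0 < M → fm M < fp M) ∧
      -- the maximizers
      ∀ M₀ E₀ : ℝ, 0 < M₀ → 0 < E₀ →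
        (fm M₀ < E₀ → E₀ < fp M₀ →
          (∃! q : ℝ × ℝ, IsBoseParam ω q.1 q.2 ∧ bose ω q.1 q.2 ∈ constraintSet ω M₀ E₀) ∧
          ∀ μ ν : ℝ, IsBoseParam ω μ ν → bose ω μ ν ∈ constraintSet ω M₀ E₀ →
            ∀ ρ : Measure (Torus d), IsMaximizer ω M₀ E₀ ρ ↔ ρ = bose ω μ ν) ∧
        (fp M₀ ≤ E₀ → E₀ < M₀ →
          ∃ t m : ℝ, 0 < t ∧ 0 ≤ m ∧
            mass (bose ω (-t) t) + ENNReal.ofReal m = ENNReal.ofReal M₀ ∧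
            energy ω (bose ω (-t) t) + ENNReal.ofReal m = ENNReal.ofReal E₀ ∧
            ∀ ρ : Measure (Torus d), IsMaximizer ω M₀ E₀ ρ ↔
              ∃ σ : Measure (Torus d), σ ⟂ₘ volume ∧ σ {p | ω p ≠ 1} = 0 ∧
                mass σ = ENNReal.ofReal m ∧ ρ = bose ω (-t) t + σ) ∧
        (a * M₀ < E₀ → E₀ ≤ fm M₀ →
          ∃ t m : ℝ, 0 < t ∧ 0 ≤ m ∧
            mass (bose ω t (-a * t)) + ENNReal.ofReal m = ENNReal.ofReal M₀ ∧
            energy ω (bose ω t (-a * t)) + ENNReal.ofReal (a * m) = ENNReal.ofReal E₀ ∧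
            ∀ ρ : Measure (Torus d), IsMaximizer ω M₀ E₀ ρ ↔
              ∃ σ : Measure (Torus d), σ ⟂ₘ volume ∧ σ {p | ω p ≠ a} = 0 ∧
                mass σ = ENNReal.ofReal m ∧ ρ = bose ω t (-a * t) + σ) := by
  have hωI : ∀ p, ω p ∈ Icc a 1 := fun p =>
    ⟨hmin.2 (mem_range_self p), hmax.2 (mem_range_self p)⟩
  have hω0 : ∀ p, 0 ≤ ω p := fun p => ha.trans (hωI p).1
  have hω1 : ∀ p, ω p ≤ 1 := fun p => (hωI p).2
  obtain ⟨pa, hpa⟩ := hmin.1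
  obtain ⟨p1, hp1⟩ := hmax.1
  have hae1 : ∀ᵐ p, ω p ≠ 1 := by
    rw [ae_iff]
    simpa only [not_not] using hmax0
  have haea : ∀ᵐ p, ω p ≠ a := by
    rw [ae_iff]
    simpa only [not_not] using hmin0
  have hu : ∀ᵐ p, 0 < 1 - ω p := hae1.mono fun p hp => sub_pos.2 ((hω1 p).lt_of_ne hp)
  have hv : ∀ᵐ p, 0 < ω p - a := haea.mono fun p hp => sub_pos.2 ((hωI p).1.lt_of_ne' hp)
  -- Both extremal level sets are null, so some point has `a < ω p < 1`.
  have ha1 : a < 1 := by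
    obtain ⟨p, h1, h2⟩ := (hu.and hv).exists
    linarith
  have huc : Continuous fun p => 1 - ω p := continuous_const.sub hω
  have hvc : Continuous fun p => ω p - a := hω.sub continuous_const
  have huI : ∀ p, 1 - ω p ∈ Icc (0 : ℝ) 1 := fun p =>
    ⟨sub_nonneg.2 (hω1 p), by linarith [hω0 p]⟩
  have hvI : ∀ p, ω p - a ∈ Icc (0 : ℝ) 1 := fun p =>
    ⟨sub_nonneg.2 (hωI p).1, by linarith [hω1 p]⟩
  obtain ⟨F₁, hF₁⟩ := exists_isBoundaryFunction (P := volume) huc.measurable hu huI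
    (volume_lt_ne_zero huc (p₀ := p1) (by rw [hp1, sub_self]))
  obtain ⟨F₂, hF₂⟩ := exists_isBoundaryFunction (P := volume) hvc.measurable hv hvI
    (volume_lt_ne_zero hvc (p₀ := pa) (by rw [hpa, sub_self]))
  have hge₁ : ∀ p, ω p = 1 + -1 * (1 - ω p) := fun p => by ring
  have hge₂ : ∀ p, ω p = a + 1 * (ω p - a) := fun p => by ring
  have hK := measureReal_univ_torus d
  -- The averages of `1 - ω` and `ω - a` sum to `1 - a`, so the two strict average bounds give `F₁ M
  -- + F₂ M < (1 - a) M`.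
  have hlt : ∀ M, 0 < M → a * M + F₂ M < M - F₁ M := by
    intro M hM
    have h1 := hF₁.lt_average M hM
    have h2 := hF₂.lt_average M hM
    have hωi : Integrable ω := integrable_of_continuous hω
    have hKpos : 0 < (volume : Measure (Torus d)).real univ := by rw [hK]; positivity
    have h3 : (∫ p, (1 - ω p)) / (volume : Measure (Torus d)).real univ +
        (∫ p, (ω p - a)) / (volume : Measure (Torus d)).real univ = 1 - a := by
      rw [integral_sub (integrable_const _) hωi, integral_sub hωi (integrable_const _),
        integral_const, integral_const, smul_eq_mul, smul_eq_mul]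
      field_simp
      ring
    have h4 := congrArg (fun z => M * z) h3
    simp only [mul_add] at h4
    linarith
  refine ⟨fun M => M - F₁ M, fun M => a * M + F₂ M, ⟨?_, fun h => ?_, fun h M _ => ?_⟩,
    ⟨?_, fun h => ?_, fun h M _ => ?_⟩, differentiableOn_id.sub hF₁.differentiableOn,
    (differentiableOn_id.const_mul a).add hF₂.differentiableOn, ?_, ?_, ?_, ?_, ?_, hlt, ?_⟩
  · simp [hF₁.zero]
  · have := hF₁.image_eq_graph hω hω0 hω1 huc.measurable hu huI hge₁ h (μ := fun t => -t)
      (ν := fun t => t) (fun t p => by ring)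
    simp only [one_mul, neg_mul, ← sub_eq_add_neg] at this
    exact this
  · simp [hF₁.eq_zero h]
  · simp [hF₂.zero]
  · have := hF₂.image_eq_graph hω hω0 hω1 hvc.measurable hv hvI hge₂ h (μ := fun t => t)
      (ν := fun t => -a * t) (fun t p => by ring)
    simp only [one_mul] at this
    exact this
  · simp [hF₂.eq_zero h]
  · refine hF₁.strictMonoOn_sub ?_
    filter_upwards [hv] with p hp
    linarith
  · exact fun x hx y hy hxy =>
      add_le_add (mul_le_mul_of_nonneg_left hxy ha) (hF₂.monotoneOn hx hy hxy)
  · rintro (h | h) x hx y hy hxy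
    · exact add_lt_add_of_lt_of_le (mul_lt_mul_of_pos_left hxy h) (hF₂.monotoneOn hx hy hxy.le)
    · exact add_lt_add_of_le_of_lt (mul_le_mul_of_nonneg_left hxy.le ha)
        (hF₂.strictMonoOn h hx hy hxy)
  · have h := hF₁.tendsto_div.const_sub 1
    rw [hK] at h
    refine h.congr' ?_
    filter_upwards [eventually_gt_atTop 0] with M hM
    field_simp
  · have h := hF₂.tendsto_div.const_add a
    rw [hK] at h
    refine h.congr' ?_
    filter_upwards [eventually_gt_atTop 0] with M hM
    field_simp
  · intro M₀ E₀ hM hE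
    refine ⟨fun h1 h2 => ⟨?_, fun μ ν hparam hmem =>
      isMaximizer_iff_eq_bose hω hω0 ⟨pa, hpa⟩ hmin0 hM.le hE.le hparam hmem⟩,
      fun h1 h2 => ?_, fun h1 h2 => ?_⟩
    · have hF₁0 : 0 ≤ F₁ M₀ := hF₁.zero ▸ hF₁.monotoneOn self_mem_Ici hM.le hM.le
      have hF₂0 : 0 ≤ F₂ M₀ := hF₂.zero ▸ hF₂.monotoneOn self_mem_Ici hM.le hM.le
      obtain ⟨μ, ν, hparam, hmem⟩ := exists_bose_mem_constraintSet (E₀ := E₀) hω ha ha1 hωI hu hv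
        hF₁ hF₂ hM (by linarith) (by linarith) (by linarith) (by linarith)
      refine ⟨(μ, ν), ⟨hparam, hmem⟩, ?_⟩
      rintro ⟨μ', ν'⟩ ⟨hparam', hmem'⟩
      -- Any second admissible equilibrium is also a maximizer, so the two measures coincide and
      -- `bose_injective` identifies the parameters.
      have hmax' := (isMaximizer_iff_eq_bose hω hω0 ⟨pa, hpa⟩ hmin0 hM.le hE.le hparam' hmem'
        (bose ω μ' ν')).2 rfl
      have heq := (isMaximizer_iff_eq_bose hω hω0 ⟨pa, hpa⟩ hmin0 hM.le hE.le hparam hmem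
        (bose ω μ' ν')).1 hmax'
      have hfin : mass (bose ω μ' ν') ≠ ∞ := by rw [hmem'.1]; exact ENNReal.ofReal_ne_top
      obtain ⟨rfl, rfl⟩ := bose_injective hω (p := pa) (q := p1) (by rw [hpa, hp1]; exact ha1.ne)
        hparam' hparam hfin heq
      rfl
    · obtain ⟨t, m, ht, hm, h⟩ := hF₁.exists_condensate hω hω0 hω1 huc.measurable hu huI hge₁
        (by norm_num) zero_le_one ⟨p1, hp1⟩ hmax0 hM hE (by linarith) (by linarith)
      have := h (-t) t fun p => by ring
      rw [one_mul] at this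
      exact ⟨t, m, ht, hm, this⟩
    · obtain ⟨t, m, ht, hm, h⟩ := hF₂.exists_condensate hω hω0 hω1 hvc.measurable hv hvI hge₂
        (by norm_num) ha ⟨pa, hpa⟩ hmin0 hM hE (by linarith) (by linarith)
      exact ⟨t, m, ht, hm, h t (-a * t) fun p => by ring⟩
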